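/- Let $H$ be a real or complex Hilbert space with inner product $(\cdot,\cdot)$ and norm $|\cdot|$. Let $A$ be a densely defined, selfadjoint, positive definite linear operator on $H$, that is, $(Ax,x)>0$ for all $0\neq x\in D(A)$. Let $V=D(A^{1/2})$ with norm $\|v\|=|A^{1/2}v|$, and regard $A$ also as the map from $V$ into its antidual $V'$ given by $(Au,v)=(A^{1/2}u,A^{1/2}v)$ for $u,v\in V$; here $H$ is embedded in $V'$ by $f\mapsto (f,\cdot)$. Let $T>0$, $N\in\mathbb N$, $N\ge 1$, $\tau=T/N$, $\sigma\ge 0$, and let $\nu$ be a finite positive Borel measure on $[0,1]$ (a Dirac measure, a finite positive combination of Dirac measures, and an integrable nonnegative density give the single-term, multi-term and distributed-order models). For $k\in\{3,4,5,6\}$ and $\alpha\in[0,1]$ let $g_j^{k}=g_j^{k}(\alpha)$ be the coefficients of the power series at $0$ $$g(\zeta)=\Big(\sum_{j=1}^{k}\tfrac1j\,(1-e^{-\sigma\tau}\zeta)^j\Big)^{\alpha}=\sum_{j=0}^\infty g_j^{k}\zeta^j ,$$ and for a sequence $(\varphi^n)$ in $H$ put $$P(\bar\partial_\tau)\varphi^n=\int_0^1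 \tau^{-\alpha}\sum_{j=0}^{n} g_j^{k}(\alpha)\,\varphi^{n-j}\,d\nu(\alpha).$$ The corrected BDF$k$ scheme for $P(\partial_t)(u-e^{-\sigma t}\varrho)+Au=0$, $u(0)=\varrho$, with initial value $u^0=\varrho\in V$, seeks $u^1,\dots,u^N\in V$ such that, in $V'$, $$P(\bar\partial_\tau)(u^n-e^{-\sigma n\tau}\varrho)+Au^n=-e^{-\sigma n\tau}a_n^{(k)}A\varrho\quad(1\le n\le \min(k-1,N)),$$ $$P(\bar\partial_\tau)(u^n-e^{-\sigma n\tau}\varrho)+Au^n=0\quad(k\le n\le N),$$ where $(a_1^{(3)},a_2^{(3)})=(\frac{11}{12},-\frac5{12})$, $(a_1^{(4)},a_2^{(4)},a_3^{(4)})=(\frac{31}{24},-\frac76,\frac38)$, $(a_1^{(5)},\dots,a_4^{(5)})=(\frac{1181}{720},-\frac{177}{80},\frac{341}{240},-\frac{251}{720})$ and $(a_1^{(6)},\dots,a_5^{(6)})=(\frac{2837}{1440},-\frac{2543}{720},\frac{17}{5},-\frac{1201}{720},\frac{95}{288})$. Theorem. For each $k\in\{3,4,5,6\}$ there is a constant $C>0$,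 depending only on $k$, such that the following holds for all $H,A,\nu,\sigma,T,N$ as above. Let $u^0,\dots,u^N$ and $\tilde u^0,\dots,\tilde u^N$ in $V$ satisfy the corrected BDF$k$ scheme with initial values $\varrho=u^0$ and $\varrho=\tilde u^0$, respectively, and put $\epsilon^n=\tilde u^n-u^n$. Then $$\tau\sum_{n=1}^N\|\epsilon^n\|^2\le C\,\tau\sum_{n=1}^N\|\epsilon^0\|^2\qquad\text{and}\qquad \tau\sum_{n=1}^N\|\epsilon^n\|\le C\,T\,\|\epsilon^0\| .$$ -/

import Mathlib

open scoped InnerProductSpace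
noncomputable section
namespace BDFSubdiffusion
/-- The (possibly unbounded) operator `A` on the Hilbert space `H`, with domain `D(A) = A.domain`, is
densely defined, selfadjoint and positive definite: `(A x, x) > 0` for all `x ∈ D(A)`, `x ≠ 0`. -/
structure IsPosDefSelfAdjoint {𝕜 H : Type*} [RCLike 𝕜] [NormedAddCommGroup H]
    [InnerProductSpace 𝕜 H] [CompleteSpace H] (A : H →ₗ.[𝕜] H) : Prop where
  dense_domain : Dense (A.domain : Set H)
  selfAdjoint : IsSelfAdjoint A
  pos : ∀ x : A.domain, x ≠ 0 → 0 < RCLike.re ⟪A x, (x : H)⟫_𝕜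

/-- `B` is the positive square root `A^{1/2}`: `B` is selfadjoint, `(B x, x) ≥ 0` on `D(B)`, and
`B ∘ B = A`, domains included (the graph of `A` is the composition of the graph of `B` with
itself). -/
structure IsPositiveSqrt {𝕜 H : Type*} [RCLike 𝕜] [NormedAddCommGroup H]
    [InnerProductSpace 𝕜 H] [CompleteSpace H] (B A : H →ₗ.[𝕜] H) : Prop where
  dense_domain : Dense (B.domain : Set H)
  selfAdjoint : IsSelfAdjoint B
  nonneg : ∀ x : B.domain, 0 ≤ RCLike.re ⟪B x, (x : H)⟫_𝕜
  sq : ∀ x y : H, (x, y) ∈ A.graph ↔ ∃ z : H, (x, z) ∈ B.graph ∧ (z, y) ∈ B.graph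

/-- A bounded operator `1 - S`, with `S` symmetric and `‖S‖ ≤ 1`, has a square root `1 - Y`. -/
theorem exists_sqrt_one_sub {𝕜 H : Type*} [RCLike 𝕜] [NormedAddCommGroup H]
    [InnerProductSpace 𝕜 H] [CompleteSpace H] (S : H →L[𝕜] H)
    (hS : (S : H →ₗ[𝕜] H).IsSymmetric) (hn : ‖S‖ ≤ 1) :
    ∃ Y : H →L[𝕜] H, (Y : H →ₗ[𝕜] H).IsSymmetric ∧ ‖Y‖ ≤ 1 ∧ (1 - Y) * (1 - Y) = 1 - S ∧
      ∀ Z : H →L[𝕜] H, Commute Z S → Commute Z Y := by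
  let Y : ℕ → H →L[𝕜] H := fun n => Nat.rec 0 (fun _ Z => (2⁻¹ : 𝕜) • (S + Z * Z)) n
  let y : ℕ → ℝ := fun n => Nat.rec 0 (fun _ z => 2⁻¹ * (1 + z * z)) n
  have Ys (n) : Y (n + 1) = (2⁻¹ : 𝕜) • (S + Y n * Y n) := rfl
  have ys (n) : y (n + 1) = 2⁻¹ * (1 + y n * y n) := rfl
  have h2 : ‖(2⁻¹ : 𝕜)‖ = 2⁻¹ := by simp
  have hy (n) : 0 ≤ y n ∧ y n ≤ 1 := by
    induction n with
    | zero => exact ⟨le_rfl, zero_le_one⟩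
    | succ n ih => rw [ys]; constructor <;> nlinarith [ih.1, ih.2]
  have hY (n) : ‖Y n‖ ≤ y n := by
    induction n with
    | zero => simp [Y, y]
    | succ n ih =>
      rw [Ys, ys, norm_smul, h2]
      have h1 := norm_add_le S (Y n * Y n)
      have h3 := norm_mul_le (Y n) (Y n)
      have h4 := mul_le_mul ih ih (norm_nonneg _) (hy n).1
      linarith
  have hd (n) : ‖Y (n + 1) - Y n‖ ≤ y (n + 1) - y n := by
    induction n with
    | zero =>
      change ‖(2⁻¹ : 𝕜) • (S + 0 * 0) - 0‖ ≤ 2⁻¹ * (1 + 0 * 0) - 0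
      rw [mul_zero, add_zero, sub_zero, norm_smul, h2]
      linarith
    | succ n ih =>
      have e : Y (n + 1 + 1) - Y (n + 1)
          = (2⁻¹ : 𝕜) • (Y (n + 1) * (Y (n + 1) - Y n) + (Y (n + 1) - Y n) * Y n) := by
        rw [Ys (n + 1)]
        nth_rewrite 3 [Ys n]
        rw [← smul_sub]
        congr 1
        noncomm_ring
      have e2 : y (n + 1 + 1) - y (n + 1)
          = 2⁻¹ * (y (n + 1) * (y (n + 1) - y n) + (y (n + 1) - y n) * y n) := by
        rw [ys (n + 1)]
        nth_rewrite 3 [ys n]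
        ring
      rw [e, e2, norm_smul, h2]
      have h1 := norm_add_le (Y (n + 1) * (Y (n + 1) - Y n)) ((Y (n + 1) - Y n) * Y n)
      have h3 := norm_mul_le (Y (n + 1)) (Y (n + 1) - Y n)
      have h4 := norm_mul_le (Y (n + 1) - Y n) (Y n)
      have h5 := mul_le_mul (hY (n + 1)) ih (norm_nonneg _) (hy (n + 1)).1
      have h6 := mul_le_mul ih (hY n) (norm_nonneg _) ((norm_nonneg _).trans ih)
      linarith
  have hsum : Summable fun n => y (n + 1) - y n := by
    refine summable_of_sum_range_le (c := 1) (fun n => (norm_nonneg _).trans (hd n)) fun n => ?_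
    rw [Finset.sum_range_sub]
    have := (hy n).2
    have h0 : y 0 = 0 := rfl
    linarith
  have hc : CauchySeq Y := cauchySeq_of_dist_le_of_summable _
    (fun n => by rw [dist_comm, dist_eq_norm]; exact hd n) hsum
  obtain ⟨L, hL⟩ := cauchySeq_tendsto_of_complete hc
  have hLs : L = (2⁻¹ : 𝕜) • (S + L * L) :=
    tendsto_nhds_unique ((Filter.tendsto_add_atTop_iff_nat 1).2 hL)
      ((tendsto_const_nhds.add (hL.mul hL)).const_smul _)
  refine ⟨L, ?_, ?_, ?_, ?_⟩
  · have hsym (n) : (ContinuousLinearMap.toLinearMap (Y n)).IsSymmetric := by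
      induction n with
      | zero => intro a b; simp [Y]
      | succ n ih =>
        intro a b
        have h1 := hS a b
        have h2 := ih (Y n a) b
        have h3 := ih a (Y n b)
        simp only [ContinuousLinearMap.coe_coe] at h1 h2 h3
        have h4 : (starRingEnd 𝕜) 2 = 2 := map_ofNat _ 2
        simp [Ys, inner_add_left, inner_add_right, inner_smul_left, inner_smul_right, h1, h2, h3, h4]
    intro a b
    have t1 : Filter.Tendsto (fun n => ⟪Y n a, b⟫_𝕜) Filter.atTop (nhds ⟪L a, b⟫_𝕜) :=
      ((((ContinuousLinearMap.apply 𝕜 H a).continuous.tendsto L).comp hL)).inner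
        tendsto_const_nhds
    have t2 : Filter.Tendsto (fun n => ⟪a, Y n b⟫_𝕜) Filter.atTop (nhds ⟪a, L b⟫_𝕜) :=
      tendsto_const_nhds.inner ((((ContinuousLinearMap.apply 𝕜 H b).continuous.tendsto L).comp hL))
    exact tendsto_nhds_unique t1 (t2.congr fun n => (hsym n a b).symm)
  · exact le_of_tendsto hL.norm (Filter.Eventually.of_forall fun n => (hY n).trans (hy n).2)
  · have h : L + L = S + L * L := by
      nth_rewrite 1 [hLs]
      nth_rewrite 3 [hLs]
      rw [← add_smul, show (2⁻¹ : 𝕜) + 2⁻¹ = 1 by norm_num, one_smul]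
    have : (1 - L) * (1 - L) = 1 - (L + L) + L * L := by noncomm_ring
    rw [this, h]; abel
  · intro Z hZ
    have hcm (n) : Commute Z (Y n) := by
      induction n with
      | zero => exact Commute.zero_right Z
      | succ n ih => rw [Ys]; exact (hZ.add_right (ih.mul_right ih)).smul_right _
    exact tendsto_nhds_unique (hL.const_mul Z) ((hL.mul_const Z).congr fun n => (hcm n).symm)

/-- The resolvent `R = (1 + A)⁻¹`. -/
theorem exists_resolvent {𝕜 H : Type*} [RCLike 𝕜] [NormedAddCommGroup H]
    [InnerProductSpace 𝕜 H] [CompleteSpace H] {A : H →ₗ.[𝕜] H} (hA : IsPosDefSelfAdjoint A) :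
    ∃ R : H →L[𝕜] H, (R : H →ₗ[𝕜] H).IsSymmetric ∧ ‖R‖ ≤ 1 ∧ ‖1 - R‖ ≤ 1 ∧
      ∀ x y : H, (x, y) ∈ A.graph ↔ R (x + y) = x := by
  have hsym : A.IsFormalAdjoint A := by
    have h := LinearPMap.adjoint_isFormalAdjoint (T := A) hA.dense_domain
    rwa [LinearPMap.isSelfAdjoint_def.1 hA.selfAdjoint] at h
  have hnn (x : A.domain) : 0 ≤ RCLike.re ⟪A x, (x : H)⟫_𝕜 := by
    by_cases hx : x = 0
    · simp [hx]
    · exact (hA.pos x hx).le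
  have hsq (x : A.domain) : ‖(x : H)‖ ^ 2 + ‖A x‖ ^ 2 ≤ ‖(x : H) + A x‖ ^ 2 := by
    rw [@norm_add_sq 𝕜, inner_re_symm]
    linarith [hnn x]
  have hle (x : A.domain) : ‖(x : H)‖ ≤ ‖(x : H) + A x‖ :=
    abs_le_of_sq_le_sq' (by nlinarith [hsq x, sq_nonneg ‖A x‖]) (norm_nonneg _) |>.2
  have hle' (x : A.domain) : ‖A x‖ ≤ ‖(x : H) + A x‖ :=
    abs_le_of_sq_le_sq' (by nlinarith [hsq x, sq_nonneg ‖(x : H)‖]) (norm_nonneg _) |>.2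
  let F : A.domain →ₗ[𝕜] H := A.domain.subtype + A.toFun
  have hF (x : A.domain) : F x = (x : H) + A x := rfl
  have hclosed : IsClosed (LinearMap.range F : Set H) := by
    refine isClosed_of_closure_subset fun f hf => ?_
    obtain ⟨g, hg, hgf⟩ := mem_closure_iff_seq_limit.1 hf
    choose x hx using hg
    have hcx : CauchySeq fun n => (x n : H) := by
      rw [Metric.cauchySeq_iff]
      intro ε hε
      obtain ⟨N, hN⟩ := Metric.cauchySeq_iff.1 hgf.cauchySeq ε hε
      refine ⟨N, fun m hm n hn => lt_of_le_of_lt ?_ (hN m hm n hn)⟩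
      rw [dist_eq_norm, dist_eq_norm, ← hx m, ← hx n, ← map_sub, hF]
      exact hle (x m - x n)
    obtain ⟨a, ha⟩ := cauchySeq_tendsto_of_complete hcx
    have hAx : Filter.Tendsto (fun n => A (x n)) Filter.atTop (nhds (f - a)) :=
      (hgf.sub ha).congr fun n => by rw [← hx n, hF]; abel
    have hmem : (a, f - a) ∈ A.graph :=
      hA.selfAdjoint.isClosed.mem_of_tendsto (ha.prodMk_nhds hAx)
        (Filter.Eventually.of_forall fun n => A.mem_graph (x n))
    obtain ⟨z, hz1, hz2⟩ := (LinearPMap.mem_graph_iff A).1 hmem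
    refine ⟨z, ?_⟩
    rw [hF, hz2]
    simp only at hz1 ⊢
    rw [hz1]; abel
  have htop : LinearMap.range F = ⊤ := by
    have : CompleteSpace (LinearMap.range F) := hclosed.completeSpace_coe
    rw [← Submodule.orthogonal_eq_bot_iff, Submodule.eq_bot_iff]
    intro w hw
    have h1 (x : A.domain) : ⟪-w, (x : H)⟫_𝕜 = ⟪w, A x⟫_𝕜 := by
      have := Submodule.inner_left_of_mem_orthogonal (LinearMap.mem_range_self F x) hw
      rw [hF, inner_add_right] at this
      rw [inner_neg_left]
      linear_combination -this
    have hmem : w ∈ (LinearPMap.adjoint A).domain := LinearPMap.mem_adjoint_domain_of_exists w ⟨-w, h1⟩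
    have hval : LinearPMap.adjoint A ⟨w, hmem⟩ = -w := LinearPMap.adjoint_apply_eq hA.dense_domain _ h1
    have hg : (w, -w) ∈ A.graph := by
      rw [← LinearPMap.isSelfAdjoint_def.1 hA.selfAdjoint, LinearPMap.mem_graph_iff]
      exact ⟨⟨w, hmem⟩, rfl, hval⟩
    obtain ⟨z, hz1, hz2⟩ := (LinearPMap.mem_graph_iff A).1 hg
    have h3 := hle z
    simp only at hz1 hz2
    rw [hz2, hz1] at h3
    simpa using h3
  have hex (f : H) : ∃ x : A.domain, (x : H) + A x = f := by
    have : f ∈ LinearMap.range F := htop ▸ Submodule.mem_top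
    exact this
  have hinj (x y : A.domain) (h : (x : H) + A x = y + A y) : x = y := by
    have := hle (x - y)
    rw [LinearPMap.map_sub, Submodule.coe_sub,
      show (x : H) - y + (A x - A y) = (x + A x) - (y + A y) by abel, h, sub_self, norm_zero] at this
    exact Subtype.ext (sub_eq_zero.1 (norm_le_zero_iff.1 this))
  choose r hr using hex
  let R₀ : H →ₗ[𝕜] H :=
    { toFun := fun f => r f
      map_add' := fun f g => by
        rw [← Submodule.coe_add]
        congr 1
        apply hinj
        rw [LinearPMap.map_add, hr, Submodule.coe_add]
        nth_rewrite 1 [← hr f, ← hr g]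
        abel
      map_smul' := fun c f => by
        rw [RingHom.id_apply, ← Submodule.coe_smul]
        congr 1
        apply hinj
        rw [LinearPMap.map_smul, hr, Submodule.coe_smul]
        nth_rewrite 1 [← hr f]
        rw [smul_add] }
  let R : H →L[𝕜] H := R₀.mkContinuous 1 fun f => by
    have := hle (r f)
    rw [hr] at this
    simpa [R₀] using this
  have hR (f) : R f = r f := rfl
  refine ⟨R, ?_, LinearMap.mkContinuous_norm_le _ zero_le_one _, ?_, ?_⟩
  · intro f g
    change ⟪(r f : H), g⟫_𝕜 = ⟪f, (r g : H)⟫_𝕜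
    have h := hsym (r f) (r g)
    calc ⟪(r f : H), g⟫_𝕜 = ⟪(r f : H), (r g : H) + A (r g)⟫_𝕜 := by rw [hr]
      _ = ⟪(r f : H) + A (r f), (r g : H)⟫_𝕜 := by rw [inner_add_left, inner_add_right, h]
      _ = ⟪f, (r g : H)⟫_𝕜 := by rw [hr]
  · refine ContinuousLinearMap.opNorm_le_bound _ zero_le_one fun f => ?_
    have h := hle' (r f)
    rw [hr] at h
    have e : (1 - R) f = A (r f) := by
      change f - R f = _
      rw [hR]
      nth_rewrite 1 [← hr f]
      abel
    rw [e, one_mul]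
    exact h
  · intro x y
    rw [hR, LinearPMap.mem_graph_iff]
    constructor
    · rintro ⟨z, rfl, rfl⟩
      rw [hinj _ _ (hr _)]
    · intro h
      refine ⟨r (x + y), h, ?_⟩
      have := hr (x + y)
      rw [h] at this
      exact add_left_cancel this

/-- Existence of the positive square root `A^{1/2} = (1 - R)^{1/2} R^{-1/2}`, where
`R = (1 + A)⁻¹`. -/
theorem exists_isPositiveSqrt {𝕜 H : Type*} [RCLike 𝕜] [NormedAddCommGroup H]
    [InnerProductSpace 𝕜 H] [CompleteSpace H] {A : H →ₗ.[𝕜] H} (hA : IsPosDefSelfAdjoint A) :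
    ∃ B : H →ₗ.[𝕜] H, IsPositiveSqrt B A := by
  obtain ⟨R, hRs, hR1, hR2, hRA⟩ := exists_resolvent hA
  have hsub {T : H →L[𝕜] H} (hT : (T : H →ₗ[𝕜] H).IsSymmetric) :
      ((1 - T : H →L[𝕜] H) : H →ₗ[𝕜] H).IsSymmetric := fun a b => by
    have := hT a b
    simp only [ContinuousLinearMap.coe_coe] at this
    simp [inner_sub_left, inner_sub_right, this]
  obtain ⟨Y, hYs, hY1, hY2, hYc⟩ := exists_sqrt_one_sub (1 - R) (hsub hRs) hR2
  obtain ⟨Z, hZs, hZ1, hZ2, hZc⟩ := exists_sqrt_one_sub R hRs hR1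
  obtain ⟨W', hWs', -, hW2, hWc⟩ := exists_sqrt_one_sub Z hZs hZ1
  set S := 1 - Y with hS
  set Q := 1 - Z with hQ
  set W := 1 - W' with hW
  rw [sub_sub_cancel] at hY2
  have hSs := hsub hYs
  have hQs := hsub hZs
  have hWs := hsub hWs'
  have cSR : Commute S R := by
    have : Commute R Y := hYc R ((Commute.one_right R).sub_right (Commute.refl R))
    exact (Commute.one_left R).sub_left this.symm
  have cSZ : Commute S Z := hZc S cSR
  have cSQ : Commute S Q := (Commute.one_right S).sub_right cSZ
  have cSW : Commute S W := (Commute.one_right S).sub_right (hWc S cSZ)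
  have aSQ (x) : S (Q x) = Q (S x) := DFunLike.congr_fun cSQ.eq x
  have aSS (x) : S (S x) = R x := DFunLike.congr_fun hY2 x
  have aQQ (x) : Q (Q x) = x - R x := DFunLike.congr_fun hZ2 x
  have aWW (x) : W (W x) = Q x := DFunLike.congr_fun hW2 x
  have aSW (x) : S (W x) = W (S x) := DFunLike.congr_fun cSW.eq x
  have sS (x y) : ⟪S x, y⟫_𝕜 = ⟪x, S y⟫_𝕜 := hSs x y
  have sQ (x y) : ⟪Q x, y⟫_𝕜 = ⟪x, Q y⟫_𝕜 := hQs x y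
  have sW (x y) : ⟪W x, y⟫_𝕜 = ⟪x, W y⟫_𝕜 := hWs x y
  have hSpos (x : H) : 0 ≤ RCLike.re ⟪S x, x⟫_𝕜 := by
    have h1 : RCLike.re ⟪Y x, x⟫_𝕜 ≤ ‖x‖ * ‖x‖ :=
      (re_inner_le_norm _ _).trans (mul_le_mul_of_nonneg_right
        ((Y.le_opNorm x).trans (by nlinarith [norm_nonneg x])) (norm_nonneg x))
    have h2 : ⟪S x, x⟫_𝕜 = ⟪x, x⟫_𝕜 - ⟪Y x, x⟫_𝕜 := by simp [hS, inner_sub_left]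
    rw [h2, map_sub, inner_self_eq_norm_mul_norm]
    linarith
  have hSinj : Function.Injective (S : H →ₗ[𝕜] H) := by
    rw [← LinearMap.ker_eq_bot, LinearMap.ker_eq_bot']
    intro x hx
    have hx' : S x = 0 := hx
    have h1 : R x = 0 := by rw [← aSS, hx', map_zero]
    have h2 : ((0 : H), x) ∈ A.graph := (hRA 0 x).2 (by rw [zero_add, h1])
    exact A.graph_fst_eq_zero_snd h2 rfl
  let E := LinearEquiv.ofInjective (S : H →ₗ[𝕜] H) hSinj
  let B : H →ₗ.[𝕜] H := ⟨LinearMap.range (S : H →ₗ[𝕜] H), (Q : H →ₗ[𝕜] H) ∘ₗ E.symm.toLinearMap⟩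
  have hBg (x y : H) : (x, y) ∈ B.graph ↔ ∃ w, S w = x ∧ Q w = y := by
    rw [LinearPMap.mem_graph_iff]
    constructor
    · rintro ⟨z, rfl, rfl⟩
      exact ⟨E.symm z, congrArg Subtype.val (E.apply_symm_apply z), rfl⟩
    · rintro ⟨w, rfl, rfl⟩
      refine ⟨E w, rfl, ?_⟩
      change Q (E.symm (E w)) = Q w
      rw [E.symm_apply_apply]
  have hBv (w : H) (h : S w ∈ B.domain) : B ⟨S w, h⟩ = Q w := by
    obtain ⟨z, hz1, hz2⟩ := (LinearPMap.mem_graph_iff B).1 ((hBg (S w) (Q w)).2 ⟨w, rfl, rfl⟩)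
    simp only at hz1 hz2
    rw [← hz2]
    congr 1
    exact Subtype.ext hz1.symm
  have hBd : Dense (B.domain : Set H) := by
    refine hA.dense_domain.mono fun x hx => ?_
    have h1 := (hRA x (A ⟨x, hx⟩)).1 (A.mem_graph ⟨x, hx⟩)
    exact ⟨S (x + A ⟨x, hx⟩), (aSS _).trans h1⟩
  refine ⟨B, hBd, ?_, ?_, ?_⟩
  · rw [LinearPMap.isSelfAdjoint_def]
    have hform : B.IsFormalAdjoint B := by
      rintro ⟨_, ⟨a, rfl⟩⟩ ⟨_, ⟨b, rfl⟩⟩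
      simp only [ContinuousLinearMap.coe_coe]
      rw [hBv, hBv, ← sS, aSQ, sQ]
    refine le_antisymm ?_ (hform.le_adjoint hBd)
    refine LinearPMap.le_of_le_graph fun p hp => ?_
    obtain ⟨y, z⟩ := p
    obtain ⟨⟨y, hy⟩, rfl, rfl⟩ := (LinearPMap.mem_graph_iff _).1 hp
    set z := LinearPMap.adjoint B ⟨y, hy⟩ with hz
    have key (x : H) : ⟪S z, x⟫_𝕜 = ⟪Q y, x⟫_𝕜 := by
      have h1 := LinearPMap.adjoint_isFormalAdjoint (T := B) hBd ⟨y, hy⟩ ⟨S x, ⟨x, rfl⟩⟩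
      have h2 : B ⟨S x, ⟨x, rfl⟩⟩ = Q x := hBv x ⟨x, rfl⟩
      rw [sS, sQ, ← h2]
      exact h1
    have hSz : S z = Q y := ext_inner_right 𝕜 key
    have hy' : S (S y + Q z) = y := by
      rw [map_add, aSS, aSQ, hSz, aQQ]; abel
    refine (hBg y z).2 ⟨S y + Q z, hy', hSinj ?_⟩
    simp only [ContinuousLinearMap.coe_coe]
    rw [aSQ, hy', hSz]
  · rintro ⟨_, ⟨w, rfl⟩⟩
    simp only [ContinuousLinearMap.coe_coe]
    rw [hBv, ← aWW, sW, ← aSW, ← sS]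
    exact hSpos _
  · intro x y
    rw [hRA]
    constructor
    · intro h
      refine ⟨S (Q (x + y)), (hBg _ _).2 ⟨S (x + y), ?_, (aSQ _).symm⟩,
        (hBg _ _).2 ⟨Q (x + y), rfl, ?_⟩⟩
      · rw [aSS, h]
      · rw [aQQ, h]; abel
    · rintro ⟨z, h1, h2⟩
      obtain ⟨w, rfl, hw⟩ := (hBg _ _).1 h1
      obtain ⟨v, rfl, rfl⟩ := (hBg _ _).1 h2
      have e : w = S (S w + Q v) := by
        rw [map_add, aSS, aSQ, ← hw, aQQ]; abel
      rw [← aSS, ← e]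

/-- The positive square root `A^{1/2}` of `A`. -/
def sqrtOp {𝕜 H : Type*} [RCLike 𝕜] [NormedAddCommGroup H]
    [InnerProductSpace 𝕜 H] [CompleteSpace H] {A : H →ₗ.[𝕜] H} (hA : IsPosDefSelfAdjoint A) :
    H →ₗ.[𝕜] H :=
  (exists_isPositiveSqrt hA).choose

theorem isPositiveSqrt_sqrtOp {𝕜 H : Type*} [RCLike 𝕜] [NormedAddCommGroup H]
    [InnerProductSpace 𝕜 H] [CompleteSpace H] {A : H →ₗ.[𝕜] H} (hA : IsPosDefSelfAdjoint A) :
    IsPositiveSqrt (sqrtOp hA) A :=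
  (exists_isPositiveSqrt hA).choose_spec

/-- The space `V = D(A^{1/2})`, as a subspace of `H`. -/
abbrev V {𝕜 H : Type*} [RCLike 𝕜] [NormedAddCommGroup H]
    [InnerProductSpace 𝕜 H] [CompleteSpace H] {A : H →ₗ.[𝕜] H} (hA : IsPosDefSelfAdjoint A) :
    Submodule 𝕜 H :=
  (sqrtOp hA).domain

/-- The norm `‖v‖ = |A^{1/2} v|` on `V`. -/
def normV {𝕜 H : Type*} [RCLike 𝕜] [NormedAddCommGroup H]
    [InnerProductSpace 𝕜 H] [CompleteSpace H] {A : H →ₗ.[𝕜] H} (hA : IsPosDefSelfAdjoint A)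
    (v : V hA) : ℝ :=
  ‖sqrtOp hA v‖

/-- The embedding `H → V'`, `f ↦ (f, ·)`, where `V'` is realised inside the antilinear functionals
on `V`. The inner product of Mathlib is antilinear in its first argument, so that `(f, v)` is
`⟪v, f⟫`. -/
def embV' {𝕜 H : Type*} [RCLike 𝕜] [NormedAddCommGroup H]
    [InnerProductSpace 𝕜 H] [CompleteSpace H] {A : H →ₗ.[𝕜] H} (hA : IsPosDefSelfAdjoint A)
    (f : H) : V hA →ₗ⋆[𝕜] 𝕜 where
  toFun v := ⟪(v : H), f⟫_𝕜
  map_add' v w := by rw [Submodule.coe_add, inner_add_left]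
  map_smul' c v := by rw [Submodule.coe_smul, inner_smul_left, smul_eq_mul]

/-- The operator `A` as a map `V → V'`: `(A u, v) = ⟨u, v⟩ = (A^{1/2} u, A^{1/2} v)`. -/
def opV' {𝕜 H : Type*} [RCLike 𝕜] [NormedAddCommGroup H]
    [InnerProductSpace 𝕜 H] [CompleteSpace H] {A : H →ₗ.[𝕜] H} (hA : IsPosDefSelfAdjoint A)
    (u : V hA) : V hA →ₗ⋆[𝕜] 𝕜 where
  toFun v := ⟪sqrtOp hA v, sqrtOp hA u⟫_𝕜
  map_add' v w := by rw [LinearPMap.map_add, inner_add_left]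
  map_smul' c v := by rw [LinearPMap.map_smul, inner_smul_left, smul_eq_mul]

/-- `opV'` extends `A`: on `D(A) ⊆ V`, the functional `opV' u` is the element `A u` of `H`. -/
theorem opV'_eq_embV' {𝕜 H : Type*} [RCLike 𝕜] [NormedAddCommGroup H]
    [InnerProductSpace 𝕜 H] [CompleteSpace H] {A : H →ₗ.[𝕜] H} (hA : IsPosDefSelfAdjoint A)
    (u : A.domain) : ∃ h : (u : H) ∈ V hA, opV' hA ⟨u, h⟩ = embV' hA (A u) := by
  have hB := isPositiveSqrt_sqrtOp hA
  obtain ⟨z, h1, h2⟩ := (hB.sq u (A u)).1 (A.mem_graph u)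
  obtain ⟨⟨u', hu⟩, h4, h5⟩ := (LinearPMap.mem_graph_iff _).1 h1
  simp only at h4 h5
  subst h4
  obtain ⟨w, hw1, hw2⟩ := (LinearPMap.mem_graph_iff _).1 h2
  refine ⟨hu, LinearMap.ext fun v => ?_⟩
  have h := LinearPMap.adjoint_isFormalAdjoint (T := sqrtOp hA) hB.dense_domain
  rw [LinearPMap.isSelfAdjoint_def.1 hB.selfAdjoint] at h
  have h3 := h v w
  simp only at hw1 hw2
  rw [hw1, hw2, ← h5] at h3
  exact h3

/-- The generating function
`g(ζ) = (∑_{j=1}^k (1/j) (1 - e^{-στ} ζ)^j)^α`. Near `ζ = 0` the base is close to the positive number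
`1 + 1/2 + ⋯ + 1/k`, so the principal power is analytic there. -/
def bdfGen (k : ℕ) (σ τ α : ℝ) (ζ : ℂ) : ℂ :=
  (∑ j ∈ Finset.Icc 1 k, (1 / (j : ℂ)) * (1 - (Real.exp (-σ * τ) : ℂ) * ζ) ^ j) ^ (α : ℂ)

/-- The coefficient `g_j^k` of `ζ^j` in the power series of `g` at `0` (a real number). -/
def bdfCoeff (k : ℕ) (σ τ α : ℝ) (j : ℕ) : ℝ :=
  (iteratedDeriv j (bdfGen k σ τ α) 0 / (Nat.factorial j : ℂ)).re

/-- The discrete fractional substantial derivative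
`τ^{-α} ∑_{j=0}^n g_j^k φ^{n-j}` of order `α` at the time level `n`. -/
def discreteDeriv (𝕜 : Type*) {H : Type*} [RCLike 𝕜] [NormedAddCommGroup H] [InnerProductSpace 𝕜 H]
    (k : ℕ) (σ τ α : ℝ) (φ : ℕ → H) (n : ℕ) : H :=
  ((τ ^ (-α) : ℝ) : 𝕜) • ∑ j ∈ Finset.range (n + 1), (bdfCoeff k σ τ α j : 𝕜) • φ (n - j)

/-- The discrete operator `P(∂̄_τ) φ^n`, the integral over `α ∈ [0,1]` of the discrete
derivatives of order `α` with respect to the measure `ν` (a Bochner integral in `H`). -/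
def discreteP (𝕜 : Type*) {H : Type*} [RCLike 𝕜] [NormedAddCommGroup H] [InnerProductSpace 𝕜 H]
    (ν : MeasureTheory.Measure (Set.Icc (0 : ℝ) 1)) (k : ℕ) (σ τ : ℝ) (φ : ℕ → H) (n : ℕ) : H :=
  letI : NormedSpace ℝ H := NormedSpace.restrictScalars ℝ 𝕜 H
  ∫ α : Set.Icc (0 : ℝ) 1, discreteDeriv 𝕜 k σ τ α φ n ∂ν

/-- The coefficients `a_n^{(k)}` of the starting correction, for `k = 3, 4, 5, 6` and
`1 ≤ n ≤ k - 1`. -/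
def corrCoeff : ℕ → ℕ → ℝ
  | 3, 1 => 11 / 12
  | 3, 2 => -5 / 12
  | 4, 1 => 31 / 24
  | 4, 2 => -7 / 6
  | 4, 3 => 3 / 8
  | 5, 1 => 1181 / 720
  | 5, 2 => -177 / 80
  | 5, 3 => 341 / 240
  | 5, 4 => -251 / 720
  | 6, 1 => 2837 / 1440
  | 6, 2 => -2543 / 720
  | 6, 3 => 17 / 5
  | 6, 4 => -1201 / 720
  | 6, 5 => 95 / 288
  | _, _ => 0

/-- `u^0, …, u^N ∈ V` solves the corrected BDF`k` scheme with step `τ` and initial value `ϱ = u^0`: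
the equations
`P(∂̄_τ)(u^n - e^{-σnτ} ϱ) + A u^n = -e^{-σnτ} a_n^{(k)} A ϱ` for `1 ≤ n ≤ k - 1` and
`P(∂̄_τ)(u^n - e^{-σnτ} ϱ) + A u^n = 0` for `k ≤ n ≤ N` hold in `V'`. -/
structure IsCorrectedBDFSolution {𝕜 H : Type*} [RCLike 𝕜] [NormedAddCommGroup H]
    [InnerProductSpace 𝕜 H] [CompleteSpace H] {A : H →ₗ.[𝕜] H} (hA : IsPosDefSelfAdjoint A)
    (ν : MeasureTheory.Measure (Set.Icc (0 : ℝ) 1)) (k : ℕ) (σ τ : ℝ) (N : ℕ)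
    (u : ℕ → V hA) : Prop where
  starting : ∀ n : ℕ, 1 ≤ n → n ≤ k - 1 → n ≤ N →
    embV' hA (discreteP 𝕜 ν k σ τ
        (fun m => (u m : H) - (Real.exp (-σ * m * τ) : 𝕜) • (u 0 : H)) n) + opV' hA (u n)
      = -(((Real.exp (-σ * n * τ) * corrCoeff k n : ℝ) : 𝕜) • opV' hA (u 0))
  main : ∀ n : ℕ, k ≤ n → n ≤ N →
    embV' hA (discreteP 𝕜 ν k σ τ
        (fun m => (u m : H) - (Real.exp (-σ * m * τ) : 𝕜) • (u 0 : H)) n) + opV' hA (u n) = 0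

end BDFSubdiffusion

end

/-!
Write `φ n = ε n - e^{-σnτ} ε 0`, so that `φ 0 = 0` and, by linearity, `P φ n + A φ n = s n • A (ε 0)`
for `1 ≤ n ≤ N` with scalars `s n` bounded in terms of `k` only. It suffices to bound
`∑ ‖φ n‖ ^ 2` by a multiple of `N ‖ε 0‖ ^ 2`; the second estimate follows from the first by the
Cauchy-Schwarz inequality.

The equation is tested with `μ ∗ φ`, where `μ` is a fixed cubic polynomial, dilated by `e^{-στ}`
(`bdfMultiplier`). Two facts make this work. Firstly `re μ ≥ 1 / 50` on the unit disc, which gives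
coercivity of `∑ re ⟨φ n, (μ ∗ φ) n⟩`. Secondly `re (δ / μ) > 0` on the disc for the BDF symbol `δ`,
`3 ≤ k ≤ 6` (`re_bdfSymbol_div_pos`). Since also `re (1 / μ) > 0`, the argument of `δ ^ α / μ` lies
between those of `1 / μ` and `δ / μ`, so that `re (δ ^ α / μ) ≥ 0` for all `0 ≤ α ≤ 1`
(`re_cpow_mul_nonneg`). As `δ ^ α ∗ φ = (δ ^ α / μ) ∗ (μ ∗ φ)`, each order `α` contributes a
nonnegative term, and so does their average over `ν`.

Both facts enter through Herglotz' theorem (`sum_re_inner_conv_taylorCoeff_nonneg`): the lower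
triangular Toeplitz form of a function with nonnegative real part on the disc is accretive, because its
entries are Fourier coefficients and modulated Gram matrices have nonnegative sums. The positivity
of real parts is checked on the unit circle, where it is a polynomial inequality in `cos θ`, and
carried inside by the maximum principle.
-/

open Finset.HasAntidiagonal (antidiagonal)
open Polynomial (aeval)

/-! ### Toeplitz forms of functions with nonnegative real part -/

/-- The coefficient of `z ^ n` in the Taylor series of `f` at `0`. -/
noncomputable def taylorCoeff (f : ℂ → ℂ) (n : ℕ) : ℂ :=
  iteratedDeriv n f 0 / (n.factorial : ℂ)

/-- The discrete convolution `∑_{i + j = n} a i • x j` of a real sequence with a sequence of vectors,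
that is, the lower triangular Toeplitz operator with symbol `∑ a i ζ ^ i` applied to `x`. -/
def conv (𝕜 : Type*) {H : Type*} [RCLike 𝕜] [NormedAddCommGroup H] [InnerProductSpace 𝕜 H]
    (a : ℕ → ℝ) (x : ℕ → H) (n : ℕ) : H :=
  ∑ p ∈ antidiagonal n, (a p.1 : 𝕜) • x p.2

/-- The Fourier coefficients of a holomorphic function on a circle: those of negative index vanish,
the others are Taylor coefficients. -/
theorem integral_circleMap_mul_exp {F : ℂ → ℂ} (hF : DifferentiableOn ℂ F (Metric.ball 0 1))
    {r : ℝ} (hr0 : 0 < r) (hr1 : r < 1) (n m : ℕ) :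
    ∫ θ in (0 : ℝ)..2 * Real.pi,
        F (circleMap 0 r θ) * Complex.exp (-(((n : ℝ) - m) * θ : ℝ) * Complex.I)
      = 2 * Real.pi * (if m ≤ n then (r : ℂ) ^ (n - m) * taylorCoeff F (n - m) else 0) := by
  have hr : (r : ℂ) ≠ 0 := by exact_mod_cast hr0.ne'
  have hd : DifferentiableOn ℂ F (Metric.closedBall 0 r) :=
    hF.mono (Metric.closedBall_subset_ball hr1)
  have hI : Complex.I ≠ 0 := Complex.I_ne_zero
  split_ifs with h
  · obtain ⟨j, rfl⟩ := Nat.exists_eq_add_of_le h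
    have h1 := hd.circleIntegral_one_div_sub_center_pow_smul hr0 j
    rw [circleIntegral] at h1
    have h2 : ∀ θ : ℝ, deriv (circleMap 0 r) θ • (1 / (circleMap 0 r θ - 0) ^ (j + 1)) •
        F (circleMap 0 r θ) = (Complex.I / r ^ j) *
          (F (circleMap 0 r θ) * Complex.exp (-((((m + j : ℕ) : ℝ) - m) * θ : ℝ) * Complex.I)) := by
      intro θ
      have e : Complex.exp (θ * Complex.I) ≠ 0 := Complex.exp_ne_zero _
      have e2 : Complex.exp (-((((m + j : ℕ) : ℝ) - m) * θ : ℝ) * Complex.I)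
          = (Complex.exp (θ * Complex.I) ^ j)⁻¹ := by
        rw [← Complex.exp_nat_mul, ← Complex.exp_neg]
        congr 1
        push_cast
        ring
      rw [e2, deriv_circleMap]
      simp only [circleMap, zero_add, sub_zero, smul_eq_mul]
      field_simp
      ring
    simp only [h2] at h1
    rw [intervalIntegral.integral_const_mul] at h1
    rw [Nat.add_sub_cancel_left, taylorCoeff]
    simp only [smul_eq_mul] at h1
    have h3 : Complex.I / (r : ℂ) ^ j ≠ 0 := div_ne_zero hI (pow_ne_zero _ hr)
    apply mul_left_cancel₀ h3
    rw [h1]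
    field_simp
  · push Not at h
    obtain ⟨j, rfl⟩ := Nat.exists_eq_add_of_lt h
    have h1 : ∮ z in C(0, r), z ^ j * F z = 0 := by
      refine DiffContOnCl.circleIntegral_eq_zero hr0.le ?_
      exact ((((differentiable_id.pow j).differentiableOn).mul hd).mono
        Metric.closure_ball_subset_closedBall).diffContOnCl
    rw [circleIntegral] at h1
    have h2 : ∀ θ : ℝ, deriv (circleMap 0 r) θ • (circleMap 0 r θ ^ j * F (circleMap 0 r θ))
        = (Complex.I * r ^ (j + 1)) * (F (circleMap 0 r θ) *
          Complex.exp (-(((n : ℝ) - (n + j + 1 : ℕ)) * θ : ℝ) * Complex.I)) := by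
      intro θ
      have e2 : Complex.exp (-(((n : ℝ) - (n + j + 1 : ℕ)) * θ : ℝ) * Complex.I)
          = Complex.exp (θ * Complex.I) ^ (j + 1) := by
        rw [← Complex.exp_nat_mul]
        congr 1
        push_cast
        ring
      rw [e2, deriv_circleMap]
      simp only [circleMap, zero_add, smul_eq_mul]
      ring
    simp only [h2] at h1
    rw [intervalIntegral.integral_const_mul] at h1
    have h3 : Complex.I * (r : ℂ) ^ (j + 1) ≠ 0 := mul_ne_zero hI (pow_ne_zero _ hr)
    rw [mul_zero]
    exact (mul_eq_zero.1 h1).resolve_left h3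

section
variable {𝕜 H : Type*} [RCLike 𝕜] [NormedAddCommGroup H] [InnerProductSpace 𝕜 H]

theorem re_inner_conv (a : ℕ → ℝ) (x : ℕ → H) (v : H) (n : ℕ) :
    RCLike.re ⟪v, conv 𝕜 a x n⟫_𝕜
      = ∑ p ∈ antidiagonal n, a p.1 * RCLike.re ⟪v, x p.2⟫_𝕜 := by
  simp [conv, inner_sum, inner_smul_right]

/-- The Gram matrix of finitely many vectors, modulated by `e ^ {-i (n - m) θ}`, has a nonnegative sum
of entries: it is `‖∑ cos (n θ) x n‖ ^ 2 + ‖∑ sin (n θ) x n‖ ^ 2`. -/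
theorem exists_sum_gram_mul_exp (x : ℕ → H) (N : ℕ) (θ : ℝ) :
    ∃ s : ℝ, 0 ≤ s ∧ ∑ n ∈ Finset.range N, ∑ m ∈ Finset.range N,
      ((RCLike.re ⟪x n, x m⟫_𝕜 : ℝ) : ℂ) * Complex.exp (-(((n : ℝ) - m) * θ : ℝ) * Complex.I)
        = s := by
  have hsq (c : ℕ → ℝ) : ∑ n ∈ Finset.range N, ∑ m ∈ Finset.range N,
      RCLike.re ⟪x n, x m⟫_𝕜 * (c n * c m)
        = ‖∑ n ∈ Finset.range N, (c n : 𝕜) • x n‖ ^ 2 := by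
    rw [← @inner_self_eq_norm_sq 𝕜, sum_inner, map_sum]
    refine Finset.sum_congr rfl fun n _ => ?_
    rw [inner_sum, map_sum]
    refine Finset.sum_congr rfl fun m _ => ?_
    rw [inner_smul_left, inner_smul_right, RCLike.conj_ofReal, RCLike.re_ofReal_mul,
      RCLike.re_ofReal_mul]
    ring
  refine ⟨‖∑ n ∈ Finset.range N, (Real.cos (n * θ) : 𝕜) • x n‖ ^ 2
    + ‖∑ n ∈ Finset.range N, (Real.sin (n * θ) : 𝕜) • x n‖ ^ 2, by positivity, ?_⟩
  have him : ∑ n ∈ Finset.range N, ∑ m ∈ Finset.range N,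
      RCLike.re ⟪x n, x m⟫_𝕜 * Real.sin (((n : ℝ) - m) * θ) = 0 := by
    have h : ∑ n ∈ Finset.range N, ∑ m ∈ Finset.range N,
        RCLike.re ⟪x n, x m⟫_𝕜 * Real.sin (((n : ℝ) - m) * θ)
        = -∑ n ∈ Finset.range N, ∑ m ∈ Finset.range N,
        RCLike.re ⟪x n, x m⟫_𝕜 * Real.sin (((n : ℝ) - m) * θ) := by
      nth_rewrite 1 [Finset.sum_comm]
      simp only [← Finset.sum_neg_distrib]
      refine Finset.sum_congr rfl fun n _ => Finset.sum_congr rfl fun m _ => ?_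
      rw [inner_re_symm, ← mul_neg, ← Real.sin_neg]
      congr 2
      ring
    linarith
  rw [← hsq, ← hsq, ← Finset.sum_add_distrib]
  have e (t : ℝ) : Complex.exp (-(t : ℂ) * Complex.I)
      = (Real.cos t : ℂ) - (Real.sin t : ℂ) * Complex.I := by
    rw [Complex.exp_mul_I, Complex.cos_neg, Complex.sin_neg]
    push_cast
    ring
  simp only [e, mul_sub, Finset.sum_sub_distrib, ← mul_assoc, ← Finset.sum_mul,
    ← Complex.ofReal_mul, ← Complex.ofReal_sum, him]
  simp only [← Finset.sum_add_distrib, Complex.ofReal_zero, zero_mul, sub_zero]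
  congr 1
  refine Finset.sum_congr rfl fun n _ => Finset.sum_congr rfl fun m _ => ?_
  rw [sub_mul, Real.cos_sub]
  ring

/-- **Herglotz positivity.** If `F` has nonnegative real part on the unit disc, the lower triangular
Toeplitz operators with symbol `F` are accretive. -/
theorem sum_re_inner_conv_taylorCoeff_nonneg {F : ℂ → ℂ}
    (hF : DifferentiableOn ℂ F (Metric.ball 0 1)) (hre : ∀ z, ‖z‖ < 1 → 0 ≤ (F z).re)
    (x : ℕ → H) (N : ℕ) :
    0 ≤ ∑ n ∈ Finset.range N,
      RCLike.re ⟪x n, conv 𝕜 (fun j => (taylorCoeff F j).re) x n⟫_𝕜 := by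
  -- the form with `F` replaced by its dilation `F (r ·)`
  let Q : ℝ → ℝ := fun r => ∑ n ∈ Finset.range N, ∑ p ∈ antidiagonal n,
    (r ^ p.1 * (taylorCoeff F p.1).re) * RCLike.re ⟪x n, x p.2⟫_𝕜
  have hQc : Continuous Q := by fun_prop
  have hQ1 : Q 1 = ∑ n ∈ Finset.range N,
      RCLike.re ⟪x n, conv 𝕜 (fun j => (taylorCoeff F j).re) x n⟫_𝕜 := by
    simp [Q, re_inner_conv]
  rw [← hQ1]
  have hQr (r : ℝ) (hr0 : 0 < r) (hr1 : r < 1) : 0 ≤ Q r := by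
    let G : ℕ → ℕ → ℝ := fun n m => RCLike.re ⟪x n, x m⟫_𝕜
    have hQ2 : Q r = ∑ n ∈ Finset.range N, ∑ m ∈ Finset.range N,
        (if m ≤ n then r ^ (n - m) * (taylorCoeff F (n - m)).re else 0) * G n m := by
      refine Finset.sum_congr rfl fun n hn => ?_
      rw [← Finset.Nat.sum_antidiagonal_swap]
      simp only [Prod.fst_swap, Prod.snd_swap]
      rw [Finset.Nat.sum_antidiagonal_eq_sum_range_succ
        (fun m j => r ^ j * (taylorCoeff F j).re * RCLike.re ⟪x n, x m⟫_𝕜)]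
      have hsub : Finset.range n.succ ⊆ Finset.range N :=
        Finset.range_subset_range.2 (Finset.mem_range.1 hn)
      rw [← Finset.sum_subset hsub]
      · refine Finset.sum_congr rfl fun m hm => ?_
        rw [if_pos (Nat.lt_succ_iff.1 (Finset.mem_range.1 hm))]
      · intro m _ hm
        rw [if_neg (fun h => hm (Finset.mem_range.2 (Nat.lt_succ_of_le h))), zero_mul]
    choose s hs0 hs using exists_sum_gram_mul_exp (𝕜 := 𝕜) x N
    have hcirc : Continuous fun θ : ℝ => F (circleMap 0 r θ) := by
      refine continuous_iff_continuousAt.2 fun θ => ?_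
      refine ContinuousAt.comp (f := circleMap 0 r) ?_ (continuous_circleMap 0 r).continuousAt
      refine (hF.differentiableAt (Metric.isOpen_ball.mem_nhds ?_)).continuousAt
      simp [abs_of_pos hr0, hr1]
    have hint : ∫ θ in (0 : ℝ)..2 * Real.pi, F (circleMap 0 r θ) * (s θ : ℂ)
        = 2 * Real.pi * ∑ n ∈ Finset.range N, ∑ m ∈ Finset.range N,
          (G n m : ℂ) * (if m ≤ n then (r : ℂ) ^ (n - m) * taylorCoeff F (n - m) else 0) := by
      simp only [← hs, Finset.mul_sum]
      rw [intervalIntegral.integral_finsetSum]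
      · refine Finset.sum_congr rfl fun n _ => ?_
        rw [intervalIntegral.integral_finsetSum]
        · refine Finset.sum_congr rfl fun m _ => ?_
          rw [mul_left_comm, ← integral_circleMap_mul_exp hF hr0 hr1 n m,
            ← intervalIntegral.integral_const_mul]
          refine intervalIntegral.integral_congr fun θ _ => ?_
          simp only [G]
          ring
        · intro m _
          exact (hcirc.mul (by fun_prop)).intervalIntegrable _ _
      · intro n _
        exact (continuous_finsetSum _ fun m _ => hcirc.mul (by fun_prop)).intervalIntegrable _ _
    have hsc : Continuous fun θ => (s θ : ℂ) := by
      simp only [← hs]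
      fun_prop
    have hre2 : (2 * Real.pi) * Q r
        = ∫ θ in (0 : ℝ)..2 * Real.pi, (F (circleMap 0 r θ) * (s θ : ℂ)).re := by
      have h := intervalIntegral.intervalIntegral_re
        (𝕜 := ℂ) (f := fun θ => F (circleMap 0 r θ) * (s θ : ℂ)) (μ := MeasureTheory.volume)
        ((hcirc.mul hsc).intervalIntegrable 0 (2 * Real.pi))
      simp only [RCLike.re_eq_complex_re] at h
      rw [h, hint, hQ2]
      have : (2 * (Real.pi : ℂ)) = ((2 * Real.pi : ℝ) : ℂ) := by push_cast; rfl
      rw [this, Complex.re_ofReal_mul, Complex.re_sum]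
      congr 1
      refine Finset.sum_congr rfl fun n _ => ?_
      rw [Complex.re_sum]
      refine Finset.sum_congr rfl fun m _ => ?_
      rw [Complex.re_ofReal_mul, mul_comm]
      split_ifs
      · rw [← Complex.ofReal_pow, Complex.re_ofReal_mul]
      · simp
    have hpos : 0 ≤ (2 * Real.pi) * Q r := by
      rw [hre2]
      refine intervalIntegral.integral_nonneg (by positivity) fun θ _ => ?_
      rw [Complex.re_mul_ofReal]
      exact mul_nonneg (hre _ (by simp [abs_of_pos hr0, hr1])) (hs0 θ)
    exact nonneg_of_mul_nonneg_right hpos (by positivity)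
  have ht : Filter.Tendsto Q (nhdsWithin 1 (Set.Iio 1)) (nhds (Q 1)) :=
    hQc.continuousAt.tendsto.mono_left nhdsWithin_le_nhds
  refine ge_of_tendsto ht ?_
  filter_upwards [Ioo_mem_nhdsLT (zero_lt_one' ℝ)] with r hr
  exact hQr r hr.1 hr.2

end

/-! ### Symbols with a polynomial multiplier -/

theorem taylorCoeff_mul {f g : ℂ → ℂ} (hf : AnalyticAt ℂ f 0) (hg : AnalyticAt ℂ g 0) (n : ℕ) :
    taylorCoeff (fun z => f z * g z) n
      = ∑ p ∈ antidiagonal n, taylorCoeff f p.1 * taylorCoeff g p.2 := by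
  rw [taylorCoeff, iteratedDeriv_fun_mul hf.contDiffAt hg.contDiffAt,
    Finset.Nat.sum_antidiagonal_eq_sum_range_succ (fun i j => taylorCoeff f i * taylorCoeff g j),
    Finset.sum_div]
  refine Finset.sum_congr rfl fun i hi => ?_
  have h := Nat.lt_succ_iff.1 (Finset.mem_range.1 hi)
  rw [taylorCoeff, taylorCoeff, Nat.cast_choose ℂ h]
  have h1 : (n.factorial : ℂ) ≠ 0 := Nat.cast_ne_zero.2 n.factorial_ne_zero
  have h2 : (i.factorial : ℂ) ≠ 0 := Nat.cast_ne_zero.2 i.factorial_ne_zero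
  have h3 : ((n - i).factorial : ℂ) ≠ 0 := Nat.cast_ne_zero.2 (n - i).factorial_ne_zero
  field_simp

theorem taylorCoeff_aeval (p : Polynomial ℝ) (n : ℕ) :
    taylorCoeff (fun z : ℂ => aeval z p) n = (p.coeff n : ℂ) := by
  induction p using Polynomial.induction_on' with
  | add p q hp hq =>
    simp only [map_add, Polynomial.coeff_add, Complex.ofReal_add, ← hp, ← hq, taylorCoeff]
    rw [iteratedDeriv_fun_add, add_div]
    · exact (Polynomial.contDiff_aeval p n).contDiffAt
    · exact (Polynomial.contDiff_aeval q n).contDiffAt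
  | monomial m a =>
    simp only [taylorCoeff, Polynomial.aeval_monomial, Polynomial.coeff_monomial]
    rw [iteratedDeriv_const_mul_field, iteratedDeriv_fun_pow_zero]
    have h1 : (n.factorial : ℂ) ≠ 0 := Nat.cast_ne_zero.2 n.factorial_ne_zero
    rcases eq_or_ne n m with rfl | h
    · simp [h1]
    · simp [h, h.symm]

theorem conv_conv {𝕜 H : Type*} [RCLike 𝕜] [NormedAddCommGroup H] [InnerProductSpace 𝕜 H]
    (a b : ℕ → ℝ) (x : ℕ → H) (n : ℕ) :
    conv 𝕜 a (conv 𝕜 b x) n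
      = conv 𝕜 (fun j => ∑ p ∈ antidiagonal j, b p.1 * a p.2) x n := by
  have e (j : ℕ) : ((∑ p ∈ antidiagonal j, b p.1 * a p.2 : ℝ) : 𝕜)
      = ∑ p ∈ antidiagonal j, (b p.1 : 𝕜) * a p.2 := by push_cast; rfl
  simp only [conv, e, Finset.smul_sum, Finset.sum_smul, Finset.sum_sigma']
  apply Finset.sum_nbij' (fun ⟨⟨i, _j⟩, ⟨k, l⟩⟩ ↦ ⟨(k + i, l), (k, i)⟩)
    (fun ⟨⟨_i, j⟩, ⟨k, l⟩⟩ ↦ ⟨(l, k + j), (k, j)⟩)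
  · rintro ⟨⟨i, j⟩, ⟨k, l⟩⟩ h
    simp only [Finset.mem_sigma, Finset.HasAntidiagonal.mem_antidiagonal] at h ⊢
    obtain ⟨h1, h2⟩ := h
    simp only [and_true]
    omega
  · rintro ⟨⟨i, j⟩, ⟨k, l⟩⟩ h
    simp only [Finset.mem_sigma, Finset.HasAntidiagonal.mem_antidiagonal] at h ⊢
    obtain ⟨h1, h2⟩ := h
    simp only [and_true]
    omega
  · rintro ⟨⟨i, j⟩, ⟨k, l⟩⟩ h
    simp only [Finset.mem_sigma, Finset.HasAntidiagonal.mem_antidiagonal] at h ⊢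
    rw [h.2]
  · rintro ⟨⟨i, j⟩, ⟨k, l⟩⟩ h
    simp only [Finset.mem_sigma, Finset.HasAntidiagonal.mem_antidiagonal] at h ⊢
    rw [h.2]
  · rintro ⟨⟨i, j⟩, ⟨k, l⟩⟩ h
    rw [smul_smul, mul_comm]

/-- **Discrete multiplier estimate.** If the symbol `G` is a polynomial `p` times a function of
nonnegative real part on the unit disc, then convolution with the Taylor coefficients of `G` is
positive when tested with the convolution by `p`. -/
theorem sum_re_inner_conv_conv_nonneg {𝕜 H : Type*} [RCLike 𝕜] [NormedAddCommGroup H]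
    [InnerProductSpace 𝕜 H] {F G : ℂ → ℂ} {p : Polynomial ℝ}
    (hF : DifferentiableOn ℂ F (Metric.ball 0 1)) (hre : ∀ z, ‖z‖ < 1 → 0 ≤ (F z).re)
    (hG : ∀ z, ‖z‖ < 1 → G z = aeval z p * F z) (x : ℕ → H) (N : ℕ) :
    0 ≤ ∑ n ∈ Finset.range N, RCLike.re ⟪conv 𝕜 p.coeff x n,
      conv 𝕜 (fun j => (taylorCoeff G j).re) x n⟫_𝕜 := by
  have hball : Metric.ball (0 : ℂ) 1 ∈ nhds 0 := Metric.ball_mem_nhds _ one_pos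
  have hc (j : ℕ) : (taylorCoeff G j).re
      = ∑ q ∈ antidiagonal j, p.coeff q.1 * (taylorCoeff F q.2).re := by
    have h1 : taylorCoeff G j = taylorCoeff (fun z => aeval z p * F z) j := by
      rw [taylorCoeff, taylorCoeff, Filter.EventuallyEq.iteratedDeriv_eq]
      filter_upwards [hball] with z hz
      exact hG z (by simpa using hz)
    rw [h1, taylorCoeff_mul (f := fun z => aeval z p)
      (p.differentiable_aeval.analyticAt 0) (hF.analyticAt hball), Complex.re_sum]
    refine Finset.sum_congr rfl fun q _ => ?_
    rw [taylorCoeff_aeval, Complex.re_ofReal_mul]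
  have h := sum_re_inner_conv_taylorCoeff_nonneg (𝕜 := 𝕜) hF hre (conv 𝕜 p.coeff x) N
  simpa only [conv_conv, ← hc] using h

/-- A function with nonnegative real part on the unit circle has nonnegative real part inside: this is
the maximum modulus principle for `exp (-h)`. -/
theorem re_nonneg_of_sphere {h : ℂ → ℂ} (hd : DifferentiableOn ℂ h (Metric.closedBall 0 1))
    (hs : ∀ z, ‖z‖ = 1 → 0 ≤ (h z).re) {z : ℂ} (hz : ‖z‖ ≤ 1) : 0 ≤ (h z).re := by
  have h1 : ‖Complex.exp (-h z)‖ ≤ 1 := by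
    refine Complex.norm_le_of_forall_mem_frontier_norm_le (f := fun z => Complex.exp (-h z))
      (U := Metric.ball 0 1) Metric.isBounded_ball ?_ ?_ ?_
    · exact (hd.neg.cexp.mono Metric.closure_ball_subset_closedBall).diffContOnCl
    · intro w hw
      rw [frontier_ball _ one_ne_zero, mem_sphere_zero_iff_norm] at hw
      rw [Complex.norm_exp, Complex.neg_re, Real.exp_le_one_iff]
      linarith [hs w hw]
    · rw [closure_ball _ one_ne_zero, mem_closedBall_zero_iff]
      exact hz
  rw [Complex.norm_exp, Complex.neg_re, Real.exp_le_one_iff] at h1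
  linarith

/-- If `w` and `d * w` lie in the right half plane, then so does `d ^ α * w` for `0 ≤ α ≤ 1`: its
argument lies between those of `w` and `d * w`. -/
theorem re_cpow_mul_nonneg {d w : ℂ} (hw : 0 < w.re) (hdw : 0 < (d * w).re) {α : ℝ} (h0 : 0 ≤ α)
    (h1 : α ≤ 1) : 0 ≤ (d ^ (α : ℂ) * w).re := by
  have hw0 : w ≠ 0 := by rintro rfl; simp at hw
  have hd0 : d ≠ 0 := by rintro rfl; simp at hdw
  have hnw : 0 < ‖w‖ := norm_pos_iff.2 hw0
  have hnd : 0 < ‖d‖ := norm_pos_iff.2 hd0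
  have key (t : ℝ) : ((‖d‖ ^ t : ℝ) * Complex.exp (t * d.arg * Complex.I) * w).re
      = ‖d‖ ^ t * ‖w‖ * Real.cos (t * d.arg + w.arg) := by
    have e : (‖d‖ ^ t : ℝ) * Complex.exp (t * d.arg * Complex.I) * w
        = (‖d‖ ^ t * ‖w‖ : ℝ) * Complex.exp ((t * d.arg + w.arg : ℝ) * Complex.I) := by
      nth_rewrite 1 [← Complex.norm_mul_exp_arg_mul_I w]
      push_cast
      rw [add_mul, Complex.exp_add]
      ring
    rw [e, Complex.re_ofReal_mul, Complex.exp_ofReal_mul_I_re]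
  have ed : ((‖d‖ ^ (1 : ℝ) : ℝ) : ℂ) * Complex.exp ((1 : ℝ) * d.arg * Complex.I) = d := by
    rw [Real.rpow_one, Complex.ofReal_one, one_mul, Complex.norm_mul_exp_arg_mul_I]
  have ea : ((‖d‖ ^ α : ℝ) : ℂ) * Complex.exp (α * d.arg * Complex.I) = d ^ (α : ℂ) := by
    rw [Complex.cpow_def_of_ne_zero hd0, Complex.log, add_mul, Complex.exp_add,
      Real.rpow_def_of_pos hnd, Complex.ofReal_exp]
    push_cast
    congr 2
    ring
  have hφ := Complex.abs_arg_lt_pi_div_two_iff.2 (Or.inl hw)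
  rw [abs_lt] at hφ
  have ha1 := d.neg_pi_lt_arg
  have ha2 := d.arg_le_pi
  have hcos : 0 < Real.cos (d.arg + w.arg) := by
    have h := key 1
    rw [ed] at h
    rw [h, one_mul] at hdw
    exact pos_of_mul_pos_right hdw (by positivity)
  have hlt : d.arg + w.arg < Real.pi / 2 := by
    by_contra! hc
    have := Real.cos_nonpos_of_pi_div_two_le_of_le hc (by linarith)
    linarith
  have hgt : -(Real.pi / 2) < d.arg + w.arg := by
    by_contra! hc
    have := Real.cos_nonpos_of_pi_div_two_le_of_le (x := -(d.arg + w.arg)) (by linarith)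
      (by linarith)
    rw [Real.cos_neg] at this
    linarith
  rw [← ea, key]
  refine mul_nonneg (by positivity) (Real.cos_nonneg_of_mem_Icc ⟨?_, ?_⟩) <;> nlinarith

theorem mem_slitPlane_of_re_mul_pos {d w : ℂ} (hw : 0 < w.re) (hdw : 0 < (d * w).re) :
    d ∈ Complex.slitPlane := by
  rw [Complex.mem_slitPlane_iff]
  by_contra! h
  rw [Complex.mul_re, h.2, zero_mul, sub_zero] at hdw
  nlinarith [h.1]

/-! ### The multiplier for the BDF symbols -/

/-- The symbol `∑_{j=1}^k (1 - z) ^ j / j` of the `k`-step backward differentiation formula. -/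
noncomputable def bdfSymbol (k : ℕ) (z : ℂ) : ℂ :=
  ∑ j ∈ Finset.Icc 1 k, (1 / (j : ℂ)) * (1 - z) ^ j

/-- The multiplier `(1 - z / 2) ^ 2 * (1 - 4 z / 9)` of Akrivis, Chen, Yu and Zhou, expanded. -/
noncomputable def bdfMultiplier : Polynomial ℝ :=
  1 - Polynomial.C (13 / 9) * Polynomial.X + Polynomial.C (25 / 36) * Polynomial.X ^ 2
    - Polynomial.C (1 / 9) * Polynomial.X ^ 3

theorem aeval_bdfMultiplier (z : ℂ) :
    aeval z bdfMultiplier = 1 - 13 / 9 * z + 25 / 36 * z ^ 2 - 1 / 9 * z ^ 3 := by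
  simp [bdfMultiplier, Polynomial.aeval_C]

theorem differentiable_bdfSymbol (k : ℕ) : Differentiable ℂ (bdfSymbol k) := by
  unfold bdfSymbol
  fun_prop

theorem sq_eq_of_norm_eq_one {z : ℂ} (hz : ‖z‖ = 1) : z ^ 2 = 2 * (z.re : ℂ) * z - 1 := by
  have h : z.re * z.re + z.im * z.im = 1 := by
    rw [← Complex.normSq_apply, Complex.normSq_eq_norm_sq, hz, one_pow]
  apply Complex.ext
  · simp [pow_two]
    linarith
  · simp [pow_two]
    ring

/-- On the unit circle powers of `z` are combinations of `z` and `1` with coefficients polynomial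
in `re z` (Chebyshev polynomials of the second kind). -/
theorem pow_eq_of_norm_eq_one {z : ℂ} (hz : ‖z‖ = 1) :
    z ^ 3 = (4 * (z.re : ℂ) ^ 2 - 1) * z - 2 * z.re ∧
    z ^ 4 = (8 * (z.re : ℂ) ^ 3 - 4 * z.re) * z + (1 - 4 * (z.re : ℂ) ^ 2) ∧
    z ^ 5 = (16 * (z.re : ℂ) ^ 4 - 12 * (z.re : ℂ) ^ 2 + 1) * z
      + (4 * z.re - 8 * (z.re : ℂ) ^ 3) ∧
    z ^ 6 = (32 * (z.re : ℂ) ^ 5 - 32 * (z.re : ℂ) ^ 3 + 6 * z.re) * z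
      + (-1 + 12 * (z.re : ℂ) ^ 2 - 16 * (z.re : ℂ) ^ 4) := by
  have h2 := sq_eq_of_norm_eq_one hz
  generalize (z.re : ℂ) = x at h2 ⊢
  have h3 : z ^ 3 = (4 * x ^ 2 - 1) * z - 2 * x := by linear_combination (z + 2 * x) * h2
  have h4 : z ^ 4 = (8 * x ^ 3 - 4 * x) * z + (1 - 4 * x ^ 2) := by
    linear_combination z * h3 + (4 * x ^ 2 - 1) * h2
  have h5 : z ^ 5 = (16 * x ^ 4 - 12 * x ^ 2 + 1) * z + (4 * x - 8 * x ^ 3) := by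
    linear_combination z * h4 + (8 * x ^ 3 - 4 * x) * h2
  have h6 : z ^ 6 = (32 * x ^ 5 - 32 * x ^ 3 + 6 * x) * z + (-1 + 12 * x ^ 2 - 16 * x ^ 4) := by
    linear_combination z * h5 + (16 * x ^ 4 - 12 * x ^ 2 + 1) * h2
  exact ⟨h3, h4, h5, h6⟩

theorem aeval_bdfMultiplier_of_norm_eq_one {z : ℂ} (hz : ‖z‖ = 1) :
    aeval z bdfMultiplier
      = ((-4 / 3 + 25 / 18 * z.re - 4 / 9 * z.re ^ 2 : ℝ) : ℂ) * z
        + ((11 / 36 + 2 / 9 * z.re : ℝ) : ℂ) := by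
  rw [aeval_bdfMultiplier]
  push_cast
  linear_combination 25 / 36 * sq_eq_of_norm_eq_one hz - 1 / 9 * (pow_eq_of_norm_eq_one hz).1

theorem re_mul_conj_of_norm_eq_one {z : ℂ} (hz : ‖z‖ = 1) (P Q R S : ℝ) :
    ((P * z + Q) * (starRingEnd ℂ) (R * z + S)).re
      = P * R + Q * S + (P * S + Q * R) * z.re := by
  have h : z.re * z.re + z.im * z.im = 1 := by
    rw [← Complex.normSq_apply, Complex.normSq_eq_norm_sq, hz, one_pow]
  simp
  linear_combination P * R * h

theorem re_mem_Icc_of_norm_eq_one {z : ℂ} (hz : ‖z‖ = 1) : -1 ≤ z.re ∧ z.re ≤ 1 :=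
  abs_le.1 (hz ▸ Complex.abs_re_le_norm z)

theorem le_re_bdfMultiplier {z : ℂ} (hz : ‖z‖ ≤ 1) : 1 / 50 ≤ (aeval z bdfMultiplier).re := by
  have h := re_nonneg_of_sphere (h := fun z => aeval z bdfMultiplier - (1 / 50 : ℝ))
    (bdfMultiplier.differentiable_aeval.sub_const _).differentiableOn ?_ hz
  · rw [Complex.sub_re, Complex.ofReal_re] at h
    linarith
  · intro w hw
    rw [aeval_bdfMultiplier_of_norm_eq_one hw, Complex.sub_re, Complex.ofReal_re, Complex.add_re,
      Complex.ofReal_re, Complex.re_ofReal_mul]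
    obtain ⟨h1, h2⟩ := re_mem_Icc_of_norm_eq_one hw
    generalize w.re = x at h1 h2
    -- the cubic has its minimum, about `0.04`, near `x = 11 / 20`
    nlinarith [mul_nonneg (sub_nonneg.2 h2) (sq_nonneg (x - 11 / 20)), sq_nonneg (x - 11 / 20)]

theorem aeval_bdfMultiplier_ne_zero {z : ℂ} (hz : ‖z‖ ≤ 1) : aeval z bdfMultiplier ≠ 0 := by
  intro h
  have := le_re_bdfMultiplier hz
  rw [h, Complex.zero_re] at this
  linarith

/-- On the unit circle the real part of `δ * conj μ`, for the symbol `δ` and the multiplier `μ`, is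
`1 - re z` times a polynomial in `re z` that is positive on `[-1, 1]`. -/
theorem le_re_bdfSymbol_mul_conj {k : ℕ} (hk : k = 3 ∨ k = 4 ∨ k = 5 ∨ k = 6) {z : ℂ}
    (hz : ‖z‖ = 1) :
    1 / 20 * (1 - z.re) ≤ (bdfSymbol k z * (starRingEnd ℂ) (aeval z bdfMultiplier)).re := by
  obtain ⟨h3, h4, h5, h6⟩ := pow_eq_of_norm_eq_one hz
  have h2 := sq_eq_of_norm_eq_one hz
  obtain ⟨hx1, hx2⟩ := re_mem_Icc_of_norm_eq_one hz
  have hx := sub_nonneg.2 hx2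
  rcases hk with rfl | rfl | rfl | rfl
  · have e : bdfSymbol 3 z = ((-8 / 3 + 3 * z.re - 4 / 3 * z.re ^ 2 : ℝ) : ℂ) * z
        + ((1 / 3 + 2 / 3 * z.re : ℝ) : ℂ) := by
      simp only [bdfSymbol, Finset.sum_Icc_succ_top (Nat.le_add_left 1 _), Finset.Icc_self,
        Finset.sum_singleton]
      push_cast
      linear_combination 3 / 2 * h2 - 1 / 3 * h3
    rw [e, aeval_bdfMultiplier_of_norm_eq_one hz, re_mul_conj_of_norm_eq_one hz]
    generalize z.re = x at *
    have hq : 1 / 20 ≤ 395 / 108 - 181 / 36 * x + 58 / 27 * x ^ 2 := by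
      nlinarith [sq_nonneg (x - 1)]
    linarith [mul_le_mul_of_nonneg_right hq hx]
  · have e : bdfSymbol 4 z = ((-8 / 3 + 5 * z.re - 16 / 3 * z.re ^ 2 + 2 * z.re ^ 3 : ℝ) : ℂ) * z
        + ((-2 / 3 + 8 / 3 * z.re - z.re ^ 2 : ℝ) : ℂ) := by
      simp only [bdfSymbol, Finset.sum_Icc_succ_top (Nat.le_add_left 1 _), Finset.Icc_self,
        Finset.sum_singleton]
      push_cast
      linear_combination 3 * h2 - 4 / 3 * h3 + 1 / 4 * h4
    rw [e, aeval_bdfMultiplier_of_norm_eq_one hz, re_mul_conj_of_norm_eq_one hz]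
    generalize z.re = x at *
    have hq : 1 / 20 ≤ 181 / 54 - 113 / 18 * x + 154 / 27 * x ^ 2 - 2 * x ^ 3 := by
      nlinarith [mul_nonneg hx (sq_nonneg x), sq_nonneg (x - 1), sq_nonneg x]
    linarith [mul_le_mul_of_nonneg_right hq hx]
  · have e : bdfSymbol 5 z = ((-28 / 15 + 5 * z.re - 164 / 15 * z.re ^ 2 + 10 * z.re ^ 3
          - 16 / 5 * z.re ^ 4 : ℝ) : ℂ) * z
        + ((-22 / 15 + 88 / 15 * z.re - 5 * z.re ^ 2 + 8 / 5 * z.re ^ 3 : ℝ) : ℂ) := by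
      simp only [bdfSymbol, Finset.sum_Icc_succ_top (Nat.le_add_left 1 _), Finset.Icc_self,
        Finset.sum_singleton]
      push_cast
      linear_combination 5 * h2 - 10 / 3 * h3 + 5 / 4 * h4 - 1 / 5 * h5
    rw [e, aeval_bdfMultiplier_of_norm_eq_one hz, re_mul_conj_of_norm_eq_one hz]
    generalize z.re = x at *
    have hq : 1 / 20 ≤ 551 / 270 - 131 / 30 * x + 1217 / 135 * x ^ 2 - 82 / 9 * x ^ 3
        + 16 / 5 * x ^ 4 := by
      nlinarith [sq_nonneg (x * (x - 3 / 2)), sq_nonneg (x - 1 / 2), sq_nonneg x,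
        sq_nonneg (x * (x - 1)), mul_nonneg hx (sq_nonneg x)]
    linarith [mul_le_mul_of_nonneg_right hq hx]
  · have e : bdfSymbol 6 z = ((-8 / 15 + z.re - 184 / 15 * z.re ^ 2 + 74 / 3 * z.re ^ 3
          - 96 / 5 * z.re ^ 4 + 16 / 3 * z.re ^ 5 : ℝ) : ℂ) * z
        + ((-22 / 15 + 128 / 15 * z.re - 13 * z.re ^ 2 + 48 / 5 * z.re ^ 3
          - 8 / 3 * z.re ^ 4 : ℝ) : ℂ) := by
      simp only [bdfSymbol, Finset.sum_Icc_succ_top (Nat.le_add_left 1 _), Finset.Icc_self,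
        Finset.sum_singleton]
      push_cast
      linear_combination 15 / 2 * h2 - 20 / 3 * h3 + 15 / 4 * h4 - 6 / 5 * h5 + 1 / 6 * h6
    rw [e, aeval_bdfMultiplier_of_norm_eq_one hz, re_mul_conj_of_norm_eq_one hz]
    generalize z.re = x at *
    have hq : 1 / 20 ≤ 71 / 270 + 611 / 270 * x + 667 / 135 * x ^ 2 - 515 / 27 * x ^ 3
        + 2392 / 135 * x ^ 4 - 16 / 3 * x ^ 5 := by
      -- the minimum over `[-1, 1]` is about `0.099`, attained near `x = -1 / 8`
      have h5 : x ^ 5 ≤ x ^ 4 := by nlinarith [mul_nonneg hx (pow_nonneg (sq_nonneg x) 2)]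
      rcases le_total 0 x with h0 | h0
      · nlinarith [sq_nonneg (x * (x - 10 / 13)), mul_nonneg h0 hx, sq_nonneg x]
      · have := mul_nonneg (neg_nonneg.2 h0) (sq_nonneg (x + 1 / 8))
        nlinarith [sq_nonneg (x + 2 / 15), sq_nonneg (x ^ 2)]
    linarith [mul_le_mul_of_nonneg_right hq hx]

/-- The quotient of the symbol by the multiplier has positive real part in the open unit disc. -/
theorem re_bdfSymbol_div_pos {k : ℕ} (hk : k = 3 ∨ k = 4 ∨ k = 5 ∨ k = 6) {z : ℂ}
    (hz : ‖z‖ < 1) : 0 < (bdfSymbol k z * (aeval z bdfMultiplier)⁻¹).re := by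
  -- `13/4` bounds the multiplier on the disc; the correction `1 - z` makes the inequality strict
  have h := re_nonneg_of_sphere
    (h := fun z => bdfSymbol k z * (aeval z bdfMultiplier)⁻¹
      - ((1 / 20 / (13 / 4) ^ 2 : ℝ) : ℂ) * (1 - z)) ?_ ?_ hz.le
  · rw [Complex.sub_re, Complex.re_ofReal_mul, Complex.sub_re, Complex.one_re] at h
    have h1 := (abs_le.1 (Complex.abs_re_le_norm z)).2
    linarith
  · refine DifferentiableOn.sub (DifferentiableOn.mul (differentiable_bdfSymbol k).differentiableOn
      (DifferentiableOn.inv bdfMultiplier.differentiable_aeval.differentiableOn fun w hw =>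
        aeval_bdfMultiplier_ne_zero (mem_closedBall_zero_iff.1 hw))) ?_
    fun_prop
  · intro w hw
    have h0 := aeval_bdfMultiplier_ne_zero hw.le
    have hn : ‖aeval w bdfMultiplier‖ ≤ 13 / 4 := by
      have e : aeval w bdfMultiplier
          = 1 + (-13 / 9) * w + 25 / 36 * w ^ 2 + (-1 / 9) * w ^ 3 := by
        rw [aeval_bdfMultiplier]
        ring
      rw [e]
      refine (norm_add₄_le).trans ?_
      simp only [norm_mul, norm_pow, hw]
      norm_num
    have hpos : 0 < Complex.normSq (aeval w bdfMultiplier) := Complex.normSq_pos.2 h0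
    have hle : Complex.normSq (aeval w bdfMultiplier) ≤ (13 / 4) ^ 2 := by
      rw [Complex.normSq_eq_norm_sq]
      exact pow_le_pow_left₀ (norm_nonneg _) hn 2
    have hb := le_re_bdfSymbol_mul_conj hk hw
    have hx := sub_nonneg.2 (re_mem_Icc_of_norm_eq_one hw).2
    rw [Complex.sub_re, Complex.re_ofReal_mul, Complex.sub_re, Complex.one_re, Complex.inv_def,
      ← mul_assoc, mul_comm _ (((Complex.normSq (aeval w bdfMultiplier))⁻¹ : ℝ) : ℂ),
      Complex.re_ofReal_mul, sub_nonneg, inv_mul_eq_div, le_div_iff₀ hpos]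
    refine le_trans ?_ hb
    have : 1 / 20 / (13 / 4) ^ 2 * (1 - w.re) * Complex.normSq (aeval w bdfMultiplier)
        ≤ 1 / 20 / (13 / 4) ^ 2 * (1 - w.re) * (13 / 4) ^ 2 := by gcongr
    linarith

/-! ### The discrete operator -/

theorem re_inv_bdfMultiplier_pos {z : ℂ} (hz : ‖z‖ ≤ 1) : 0 < ((aeval z bdfMultiplier)⁻¹).re := by
  rw [Complex.inv_re]
  refine div_pos ?_ (Complex.normSq_pos.2 (aeval_bdfMultiplier_ne_zero hz))
  linarith [le_re_bdfMultiplier hz]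

theorem bdfSymbol_mem_slitPlane {k : ℕ} (hk : k = 3 ∨ k = 4 ∨ k = 5 ∨ k = 6) {z : ℂ}
    (hz : ‖z‖ < 1) : bdfSymbol k z ∈ Complex.slitPlane :=
  mem_slitPlane_of_re_mul_pos (re_inv_bdfMultiplier_pos hz.le) (re_bdfSymbol_div_pos hk hz)

theorem norm_ofReal_mul_lt_one {q : ℝ} (hq0 : 0 ≤ q) (hq1 : q ≤ 1) {z : ℂ} (hz : ‖z‖ < 1) :
    ‖(q : ℂ) * z‖ < 1 := by
  rw [norm_mul, Complex.norm_real, Real.norm_of_nonneg hq0]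
  exact (mul_le_of_le_one_left (norm_nonneg z) hq1).trans_lt hz

theorem exp_neg_mul_le_one {σ τ : ℝ} (hσ : 0 ≤ σ) (hτ : 0 ≤ τ) : Real.exp (-σ * τ) ≤ 1 :=
  Real.exp_le_one_iff.2 (by nlinarith [mul_nonneg hσ hτ])

theorem bdfGen_eq (k : ℕ) (σ τ α : ℝ) (z : ℂ) :
    BDFSubdiffusion.bdfGen k σ τ α z
      = bdfSymbol k ((Real.exp (-σ * τ) : ℂ) * z) ^ (α : ℂ) := rfl

theorem differentiableOn_bdfGen {k : ℕ} (hk : k = 3 ∨ k = 4 ∨ k = 5 ∨ k = 6) {σ τ : ℝ}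
    (hσ : 0 ≤ σ) (hτ : 0 ≤ τ) (α : ℝ) :
    DifferentiableOn ℂ (BDFSubdiffusion.bdfGen k σ τ α) (Metric.ball 0 1) := by
  have hd : Differentiable ℂ fun z : ℂ => bdfSymbol k ((Real.exp (-σ * τ) : ℂ) * z) :=
    (differentiable_bdfSymbol k).comp (differentiable_id.const_mul _)
  refine hd.differentiableOn.cpow (differentiableOn_const _) fun z hz => ?_
  exact bdfSymbol_mem_slitPlane hk (norm_ofReal_mul_lt_one (Real.exp_nonneg _)
    (exp_neg_mul_le_one hσ hτ) (by simpa using hz))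

/-- By Cauchy's integral formula the coefficients depend continuously on the order `α`. -/
theorem continuous_bdfCoeff {k : ℕ} (hk : k = 3 ∨ k = 4 ∨ k = 5 ∨ k = 6) {σ τ : ℝ}
    (hσ : 0 ≤ σ) (hτ : 0 ≤ τ) (j : ℕ) :
    Continuous fun α : ℝ => BDFSubdiffusion.bdfCoeff k σ τ α j := by
  have h (α : ℝ) : taylorCoeff (BDFSubdiffusion.bdfGen k σ τ α) j
      = (∫ θ in (0 : ℝ)..2 * Real.pi, BDFSubdiffusion.bdfGen k σ τ α (circleMap 0 (1 / 2) θ)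
          * Complex.exp (-(((j : ℝ) - (0 : ℕ)) * θ : ℝ) * Complex.I))
        / (2 * Real.pi * ((1 / 2 : ℝ) : ℂ) ^ j) := by
    rw [integral_circleMap_mul_exp (differentiableOn_bdfGen hk hσ hτ α) (by norm_num)
      (by norm_num) j 0, if_pos (Nat.zero_le j), Nat.sub_zero]
    have : (Real.pi : ℂ) ≠ 0 := Complex.ofReal_ne_zero.2 Real.pi_ne_zero
    have h2 : ((1 / 2 : ℝ) : ℂ) ^ j ≠ 0 := pow_ne_zero _ (by norm_num)
    field_simp
  refine Complex.continuous_re.comp (?_ : Continuous fun α : ℝ =>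
    taylorCoeff (BDFSubdiffusion.bdfGen k σ τ α) j)
  simp only [h]
  refine Continuous.div_const ?_ _
  refine intervalIntegral.continuous_parametric_intervalIntegral_of_continuous' ?_ _ _
  refine Continuous.mul ?_ (by fun_prop)
  simp only [bdfGen_eq]
  refine Continuous.cpow ?_ (by fun_prop) fun p => ?_
  · exact (differentiable_bdfSymbol k).continuous.comp
      (continuous_const.mul ((continuous_circleMap 0 _).comp continuous_snd))
  · refine bdfSymbol_mem_slitPlane hk (norm_ofReal_mul_lt_one (Real.exp_nonneg _)
      (exp_neg_mul_le_one hσ hτ) ?_)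
    rw [norm_circleMap_zero]
    norm_num [abs_of_pos]

section
variable {𝕜 H : Type*} [RCLike 𝕜] [NormedAddCommGroup H] [InnerProductSpace 𝕜 H]

/-- The averages over `ν` are genuine: an integral that fails to exist would be read as `0`. -/
theorem integrable_rpow_mul_bdfCoeff {k : ℕ} (hk : k = 3 ∨ k = 4 ∨ k = 5 ∨ k = 6)
    (ν : MeasureTheory.Measure (Set.Icc (0 : ℝ) 1)) [MeasureTheory.IsFiniteMeasure ν] {σ τ : ℝ}
    (hσ : 0 ≤ σ) (hτ : 0 < τ) (j : ℕ) :
    MeasureTheory.Integrable (fun α : Set.Icc (0 : ℝ) 1 =>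
      τ ^ (-(α : ℝ)) * BDFSubdiffusion.bdfCoeff k σ τ α j) ν := by
  have hc : Continuous fun α : Set.Icc (0 : ℝ) 1 =>
      τ ^ (-(α : ℝ)) * BDFSubdiffusion.bdfCoeff k σ τ α j :=
    (continuous_const.rpow continuous_subtype_val.neg fun _ => Or.inl hτ.ne').mul
      ((continuous_bdfCoeff hk hσ hτ.le j).comp continuous_subtype_val)
  exact hc.integrable_of_hasCompactSupport (HasCompactSupport.of_compactSpace _)

/-- The discrete operator is the convolution with the averaged coefficients. -/
theorem discreteP_eq_conv [CompleteSpace H] {k : ℕ} (hk : k = 3 ∨ k = 4 ∨ k = 5 ∨ k = 6)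
    (ν : MeasureTheory.Measure (Set.Icc (0 : ℝ) 1)) [MeasureTheory.IsFiniteMeasure ν] {σ τ : ℝ}
    (hσ : 0 ≤ σ) (hτ : 0 < τ) (φ : ℕ → H) (n : ℕ) :
    BDFSubdiffusion.discreteP 𝕜 ν k σ τ φ n
      = conv 𝕜 (fun j => ∫ α : Set.Icc (0 : ℝ) 1,
          τ ^ (-(α : ℝ)) * BDFSubdiffusion.bdfCoeff k σ τ α j ∂ν) φ n := by
  let _ : NormedSpace ℝ H := NormedSpace.restrictScalars ℝ 𝕜 H
  have hsmul (c : ℝ) (v : H) : (c : 𝕜) • v = c • v := by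
    change (c : 𝕜) • v = (algebraMap ℝ 𝕜 c) • v
    rw [RCLike.algebraMap_eq_ofReal]
  have e (α : Set.Icc (0 : ℝ) 1) : BDFSubdiffusion.discreteDeriv 𝕜 k σ τ α φ n
      = ∑ p ∈ antidiagonal n,
        (τ ^ (-(α : ℝ)) * BDFSubdiffusion.bdfCoeff k σ τ α p.1) • φ p.2 := by
    rw [BDFSubdiffusion.discreteDeriv, Finset.Nat.sum_antidiagonal_eq_sum_range_succ
      (fun i j => (τ ^ (-(α : ℝ)) * BDFSubdiffusion.bdfCoeff k σ τ α i) • φ j), Finset.smul_sum]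
    refine Finset.sum_congr rfl fun i _ => ?_
    rw [← hsmul, smul_smul, RCLike.ofReal_mul]
  rw [BDFSubdiffusion.discreteP]
  simp only [e]
  rw [MeasureTheory.integral_finsetSum]
  · refine Finset.sum_congr rfl fun p _ => ?_
    rw [integral_smul_const, hsmul]
  · intro p _
    exact (integrable_rpow_mul_bdfCoeff hk ν hσ hτ p.1).smul_const _

theorem aeval_comp_C_mul_X (p : Polynomial ℝ) (q : ℝ) (z : ℂ) :
    aeval z (p.comp (Polynomial.C q * Polynomial.X)) = aeval ((q : ℂ) * z) p := by
  rw [Polynomial.aeval_comp]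
  simp

/-- The discrete operator is positive when tested with the multiplier. -/
theorem sum_re_inner_discreteP_nonneg [CompleteSpace H] {k : ℕ}
    (hk : k = 3 ∨ k = 4 ∨ k = 5 ∨ k = 6)
    (ν : MeasureTheory.Measure (Set.Icc (0 : ℝ) 1)) [MeasureTheory.IsFiniteMeasure ν] {σ τ : ℝ}
    (hσ : 0 ≤ σ) (hτ : 0 < τ) (φ : ℕ → H) (N : ℕ) :
    0 ≤ ∑ n ∈ Finset.range N, RCLike.re
      ⟪conv 𝕜 (bdfMultiplier.comp (Polynomial.C (Real.exp (-σ * τ)) * Polynomial.X)).coeff φ n,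
        BDFSubdiffusion.discreteP 𝕜 ν k σ τ φ n⟫_𝕜 := by
  set q := Real.exp (-σ * τ)
  have hq0 : 0 ≤ q := Real.exp_nonneg _
  have hq1 : q ≤ 1 := exp_neg_mul_le_one hσ hτ.le
  set p := bdfMultiplier.comp (Polynomial.C q * Polynomial.X)
  have hpt (α : Set.Icc (0 : ℝ) 1) : 0 ≤ ∑ n ∈ Finset.range N, RCLike.re
      ⟪conv 𝕜 p.coeff φ n, conv 𝕜 (BDFSubdiffusion.bdfCoeff k σ τ α) φ n⟫_𝕜 := by
    have hne (z : ℂ) (hz : ‖z‖ < 1) : aeval z p ≠ 0 := by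
      rw [aeval_comp_C_mul_X]
      exact aeval_bdfMultiplier_ne_zero (norm_ofReal_mul_lt_one hq0 hq1 hz).le
    refine sum_re_inner_conv_conv_nonneg (p := p) (G := BDFSubdiffusion.bdfGen k σ τ α)
      (F := fun z => BDFSubdiffusion.bdfGen k σ τ α z * (aeval z p)⁻¹) ?_ ?_ ?_ φ N
    · exact (differentiableOn_bdfGen hk hσ hτ.le α).mul
        (p.differentiable_aeval.differentiableOn.inv fun z hz => hne z (by simpa using hz))
    · intro z hz
      have hz' := norm_ofReal_mul_lt_one hq0 hq1 hz
      rw [aeval_comp_C_mul_X, bdfGen_eq]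
      exact re_cpow_mul_nonneg (re_inv_bdfMultiplier_pos hz'.le) (re_bdfSymbol_div_pos hk hz')
        α.2.1 α.2.2
    · intro z hz
      have := hne z hz
      field_simp
  have hint : ∑ n ∈ Finset.range N, RCLike.re
      ⟪conv 𝕜 p.coeff φ n, BDFSubdiffusion.discreteP 𝕜 ν k σ τ φ n⟫_𝕜
      = ∫ α : Set.Icc (0 : ℝ) 1, τ ^ (-(α : ℝ)) * ∑ n ∈ Finset.range N, RCLike.re
        ⟪conv 𝕜 p.coeff φ n, conv 𝕜 (BDFSubdiffusion.bdfCoeff k σ τ α) φ n⟫_𝕜 ∂ν := by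
    simp only [discreteP_eq_conv hk ν hσ hτ, re_inner_conv, Finset.mul_sum, ← mul_assoc]
    rw [MeasureTheory.integral_finsetSum]
    · refine Finset.sum_congr rfl fun n _ => ?_
      rw [MeasureTheory.integral_finsetSum]
      · refine Finset.sum_congr rfl fun r _ => ?_
        rw [MeasureTheory.integral_mul_const]
      · intro r _
        exact (integrable_rpow_mul_bdfCoeff hk ν hσ hτ r.1).mul_const _
    · intro n _
      refine MeasureTheory.integrable_finsetSum _ fun r _ => ?_
      exact (integrable_rpow_mul_bdfCoeff hk ν hσ hτ r.1).mul_const _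
  rw [hint]
  exact MeasureTheory.integral_nonneg fun α => mul_nonneg (Real.rpow_nonneg hτ.le _) (hpt α)

/-- Convolution with the multiplier is coercive. -/
theorem le_sum_re_inner_conv_bdfMultiplier {q : ℝ} (hq0 : 0 ≤ q) (hq1 : q ≤ 1) (x : ℕ → H)
    (N : ℕ) :
    1 / 50 * ∑ n ∈ Finset.range N, ‖x n‖ ^ 2 ≤ ∑ n ∈ Finset.range N, RCLike.re
      ⟪x n, conv 𝕜 (bdfMultiplier.comp (Polynomial.C q * Polynomial.X)).coeff x n⟫_𝕜 := by
  set p := bdfMultiplier.comp (Polynomial.C q * Polynomial.X)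
  have h := sum_re_inner_conv_taylorCoeff_nonneg (𝕜 := 𝕜)
    (F := fun z => aeval z (p - Polynomial.C (1 / 50)))
    (Polynomial.differentiable_aeval _).differentiableOn ?_ x N
  · simp only [taylorCoeff_aeval, Complex.ofReal_re, re_inner_conv, Polynomial.coeff_sub, sub_mul,
      Finset.sum_sub_distrib] at h
    have hC (n : ℕ) : ∑ r ∈ antidiagonal n, (Polynomial.C (1 / 50 : ℝ)).coeff r.1
        * RCLike.re ⟪x n, x r.2⟫_𝕜 = 1 / 50 * ‖x n‖ ^ 2 := by
      rw [Finset.sum_eq_single (0, n)]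
      · rw [Polynomial.coeff_C_zero, inner_self_eq_norm_sq]
      · rintro ⟨i, j⟩ hij hne
        rw [Polynomial.coeff_C_of_ne_zero, zero_mul]
        rintro rfl
        simp only [Finset.HasAntidiagonal.mem_antidiagonal, zero_add] at hij
        exact hne (by rw [hij])
      · intro h0
        simp at h0
    simp only [hC, ← Finset.mul_sum] at h
    simp only [re_inner_conv]
    linarith
  · intro z hz
    have := le_re_bdfMultiplier (norm_ofReal_mul_lt_one hq0 hq1 hz).le
    simp only [map_sub, Polynomial.aeval_C, p, aeval_comp_C_mul_X, Complex.coe_algebraMap,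
      Complex.sub_re, Complex.ofReal_re]
    linarith

/-- Young's inequality for convolutions in `ℓ¹`. -/
theorem sum_norm_conv_le (a : ℕ → ℝ) (x : ℕ → H) (N : ℕ) :
    ∑ n ∈ Finset.range N, ‖conv 𝕜 a x n‖
      ≤ (∑ i ∈ Finset.range N, |a i|) * ∑ n ∈ Finset.range N, ‖x n‖ := by
  calc ∑ n ∈ Finset.range N, ‖conv 𝕜 a x n‖
      ≤ ∑ n ∈ Finset.range N, ∑ p ∈ antidiagonal n, |a p.1| * ‖x p.2‖ := by
        refine Finset.sum_le_sum fun n _ => (norm_sum_le _ _).trans_eq ?_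
        refine Finset.sum_congr rfl fun p _ => ?_
        rw [norm_smul, RCLike.norm_ofReal]
    _ ≤ ∑ p ∈ Finset.range N ×ˢ Finset.range N, |a p.1| * ‖x p.2‖ := by
        rw [Finset.sum_sigma']
        refine (Finset.sum_of_injOn (fun s => s.2) ?_ ?_ ?_ ?_).le.trans
          (Finset.sum_le_sum_of_subset_of_nonneg (s := (Finset.range N ×ˢ Finset.range N).filter
            fun p => p.1 + p.2 < N) (Finset.filter_subset _ _) fun _ _ _ => by positivity)
        · rintro ⟨n, p⟩ h ⟨m, r⟩ h' e
          simp at h h' e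
          subst e
          rw [← h.2, ← h'.2]
        · rintro ⟨n, p⟩ h
          simp at h ⊢
          omega
        · rintro p hp hn
          simp at hp hn
          omega
        · intro _ _
          rfl
    _ = _ := by rw [Finset.sum_product, Finset.sum_mul_sum]

end

/-- The dilated multiplier has coefficients summable uniformly in the dilation. -/
theorem sum_abs_coeff_comp_le (p : Polynomial ℝ) {q : ℝ} (hq0 : 0 ≤ q) (hq1 : q ≤ 1) (N : ℕ) :
    ∑ i ∈ Finset.range N, |(p.comp (Polynomial.C q * Polynomial.X)).coeff i|
      ≤ ∑ i ∈ p.support, |p.coeff i| := by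
  calc _ ≤ ∑ i ∈ Finset.range N, |p.coeff i| := by
        refine Finset.sum_le_sum fun i _ => ?_
        rw [Polynomial.comp_C_mul_X_coeff, abs_mul, abs_of_nonneg (pow_nonneg hq0 i)]
        exact mul_le_of_le_one_right (abs_nonneg _) (pow_le_one₀ hq0 hq1)
    _ ≤ ∑ i ∈ Finset.range N ∪ p.support, |p.coeff i| :=
        Finset.sum_le_sum_of_subset_of_nonneg Finset.subset_union_left fun _ _ _ => abs_nonneg _
    _ = _ := by
        refine (Finset.sum_subset Finset.subset_union_right fun i _ hi => ?_).symm
        rw [Polynomial.notMem_support_iff.1 hi, abs_zero]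

/-! ### The energy estimate -/

/-- **Energy estimate.** An evolution equation `P n + B⋆B ψ n = s n • B⋆ e` with bounded scalars `s n`,
tested with a convolution `a ∗ ψ` against which `P` is nonnegative and which is coercive in the energy
norm `‖B ·‖`, controls the energy of `ψ` in the mean square. -/
theorem sum_sq_norm_le_of_multiplier {𝕜 H : Type*} [RCLike 𝕜] [NormedAddCommGroup H]
    [InnerProductSpace 𝕜 H] {W : Submodule 𝕜 H} (B : W →ₗ[𝕜] H) {ψ : ℕ → W} (hψ : ψ 0 = 0)
    {P : ℕ → H} {e : H} {a : ℕ → ℝ} {c K M : ℝ} (hc : 0 < c) (N : ℕ)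
    (hP : 0 ≤ ∑ n ∈ Finset.range (N + 1),
      RCLike.re ⟪conv 𝕜 a (fun m => (ψ m : H)) n, P n⟫_𝕜)
    (ha : c * ∑ n ∈ Finset.range (N + 1), ‖B (ψ n)‖ ^ 2 ≤ ∑ n ∈ Finset.range (N + 1),
      RCLike.re ⟪B (ψ n), conv 𝕜 a (fun m => B (ψ m)) n⟫_𝕜)
    (hM : ∑ i ∈ Finset.range (N + 1), |a i| ≤ M) (hK : 0 ≤ K)
    (heq : ∀ n ∈ Finset.Icc 1 N, ∃ s : ℝ, |s| ≤ K ∧ ∀ v : W,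
      ⟪(v : H), P n⟫_𝕜 + ⟪B v, B (ψ n)⟫_𝕜 = (s : 𝕜) * ⟪B v, e⟫_𝕜) :
    ∑ n ∈ Finset.Icc 1 N, ‖B (ψ n)‖ ^ 2 ≤ (K * M / c) ^ 2 * (N * ‖e‖ ^ 2) := by
  have hM0 : 0 ≤ M := (Finset.sum_nonneg fun _ _ => abs_nonneg _).trans hM
  have hrange : Finset.range (N + 1) = insert 0 (Finset.Icc 1 N) := by
    ext n
    simp only [Finset.mem_range, Finset.mem_insert, Finset.mem_Icc]
    omega
  have h0 : (0 : ℕ) ∉ Finset.Icc 1 N := by simp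
  have htest (n : ℕ) (hn : n ∈ Finset.range (N + 1)) :
      RCLike.re ⟪conv 𝕜 a (fun m => (ψ m : H)) n, P n⟫_𝕜
        + RCLike.re ⟪B (ψ n), conv 𝕜 a (fun m => B (ψ m)) n⟫_𝕜
        ≤ K * ‖e‖ * ‖conv 𝕜 a (fun m => B (ψ m)) n‖ := by
    rw [hrange, Finset.mem_insert] at hn
    rcases hn with rfl | hn
    · simp [conv, hψ]
    · obtain ⟨s, hs, h⟩ := heq n hn
      have h1 := congrArg RCLike.re (h (∑ p ∈ antidiagonal n, (a p.1 : 𝕜) • ψ p.2))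
      have e1 : ((∑ p ∈ antidiagonal n, (a p.1 : 𝕜) • ψ p.2 : W) : H)
          = conv 𝕜 a (fun m => (ψ m : H)) n := by simp [conv]
      have e2 : B (∑ p ∈ antidiagonal n, (a p.1 : 𝕜) • ψ p.2)
          = conv 𝕜 a (fun m => B (ψ m)) n := by simp [conv]
      rw [e1, e2, map_add, RCLike.re_ofReal_mul] at h1
      rw [inner_re_symm (B (ψ n)), h1]
      calc _ ≤ |s * RCLike.re ⟪conv 𝕜 a (fun m => B (ψ m)) n, e⟫_𝕜| := le_abs_self _
        _ ≤ K * (‖conv 𝕜 a (fun m => B (ψ m)) n‖ * ‖e‖) := by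
          rw [abs_mul]
          exact mul_le_mul hs ((RCLike.abs_re_le_norm _).trans (norm_inner_le_norm _ _))
            (abs_nonneg _) hK
        _ = _ := by ring
  have hsum := Finset.sum_le_sum htest
  rw [Finset.sum_add_distrib, ← Finset.mul_sum] at hsum
  have hconv := sum_norm_conv_le (𝕜 := 𝕜) a (fun m => B (ψ m)) (N + 1)
  have hS1 : ∑ n ∈ Finset.range (N + 1), ‖B (ψ n)‖ = ∑ n ∈ Finset.Icc 1 N, ‖B (ψ n)‖ := by
    rw [hrange, Finset.sum_insert h0, hψ, map_zero, norm_zero, zero_add]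
  have hS2 : ∑ n ∈ Finset.range (N + 1), ‖B (ψ n)‖ ^ 2
      = ∑ n ∈ Finset.Icc 1 N, ‖B (ψ n)‖ ^ 2 := by
    rw [hrange, Finset.sum_insert h0, hψ, map_zero, norm_zero]
    simp
  rw [hS2] at ha
  rw [hS1] at hconv
  have hle : c * ∑ n ∈ Finset.Icc 1 N, ‖B (ψ n)‖ ^ 2
      ≤ K * ‖e‖ * (M * ∑ n ∈ Finset.Icc 1 N, ‖B (ψ n)‖) := by
    have h1 := mul_le_mul_of_nonneg_right hM
      (Finset.sum_nonneg fun n (_ : n ∈ Finset.Icc 1 N) => norm_nonneg (B (ψ n)))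
    have h2 := mul_le_mul_of_nonneg_left (hconv.trans h1) (mul_nonneg hK (norm_nonneg e))
    linarith
  -- Young's inequality with weights chosen so that half of the left-hand side absorbs the energy
  have hyoung (n : ℕ) : K * ‖e‖ * M * ‖B (ψ n)‖
      ≤ c / 2 * ‖B (ψ n)‖ ^ 2 + c / 2 * ((K * M / c) ^ 2 * ‖e‖ ^ 2) := by
    have h := mul_nonneg (half_pos hc).le (sq_nonneg (‖B (ψ n)‖ - K * M / c * ‖e‖))
    have e1 : c / 2 * (‖B (ψ n)‖ - K * M / c * ‖e‖) ^ 2 = c / 2 * ‖B (ψ n)‖ ^ 2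
        + c / 2 * ((K * M / c) ^ 2 * ‖e‖ ^ 2) - K * ‖e‖ * M * ‖B (ψ n)‖ := by
      field_simp
      ring
    linarith
  have hy := Finset.sum_le_sum fun n (_ : n ∈ Finset.Icc 1 N) => hyoung n
  rw [Finset.sum_add_distrib, ← Finset.mul_sum, ← Finset.mul_sum, Finset.sum_const, Nat.card_Icc,
    Nat.add_sub_cancel, nsmul_eq_mul] at hy
  have : c / 2 * ∑ n ∈ Finset.Icc 1 N, ‖B (ψ n)‖ ^ 2
      ≤ c / 2 * ((K * M / c) ^ 2 * (N * ‖e‖ ^ 2)) := by linarith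
  exact le_of_mul_le_mul_left this (half_pos hc)

/-- The two equations of the scheme in one, with the correction bounded. -/
theorem exists_scheme_eq {𝕜 H : Type*} [RCLike 𝕜] [NormedAddCommGroup H]
    [InnerProductSpace 𝕜 H] [CompleteSpace H] {A : H →ₗ.[𝕜] H}
    (hA : BDFSubdiffusion.IsPosDefSelfAdjoint A)
    (ν : MeasureTheory.Measure (Set.Icc (0 : ℝ) 1)) (k : ℕ) {σ τ : ℝ} (hσ : 0 ≤ σ) (hτ : 0 ≤ τ)
    (N n : ℕ) (hn : n ∈ Finset.Icc 1 N) :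
    ∃ s : ℝ, |s| ≤ ∑ i ∈ Finset.range k, |BDFSubdiffusion.corrCoeff k i| ∧
      ∀ u : ℕ → BDFSubdiffusion.V hA, BDFSubdiffusion.IsCorrectedBDFSolution hA ν k σ τ N u →
        ∀ v : BDFSubdiffusion.V hA,
        ⟪(v : H), BDFSubdiffusion.discreteP 𝕜 ν k σ τ
          (fun m => (u m : H) - (Real.exp (-σ * m * τ) : 𝕜) • (u 0 : H)) n⟫_𝕜
          + ⟪BDFSubdiffusion.sqrtOp hA v, BDFSubdiffusion.sqrtOp hA (u n)⟫_𝕜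
        = (s : 𝕜) * ⟪BDFSubdiffusion.sqrtOp hA v, BDFSubdiffusion.sqrtOp hA (u 0)⟫_𝕜 := by
  rw [Finset.mem_Icc] at hn
  rcases Nat.lt_or_ge n k with h | h
  · refine ⟨-(Real.exp (-σ * n * τ) * BDFSubdiffusion.corrCoeff k n), ?_, fun u hu v => ?_⟩
    · have h1 : Real.exp (-σ * n * τ) ≤ 1 :=
        Real.exp_le_one_iff.2 (by
          have := mul_nonneg (mul_nonneg hσ n.cast_nonneg) hτ
          linarith)
      rw [abs_neg, abs_mul, abs_of_pos (Real.exp_pos _)]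
      refine (mul_le_of_le_one_left (abs_nonneg _) h1).trans ?_
      exact Finset.single_le_sum (f := fun i => |BDFSubdiffusion.corrCoeff k i|)
        (fun _ _ => abs_nonneg _) (Finset.mem_range.2 h)
    · have h2 := DFunLike.congr_fun (hu.starting n hn.1 (Nat.le_sub_one_of_lt h) hn.2) v
      rw [RCLike.ofReal_neg, neg_mul]
      exact h2
  · refine ⟨0, ?_, fun u hu v => ?_⟩
    · rw [abs_zero]
      exact Finset.sum_nonneg fun _ _ => abs_nonneg _
    · have h2 := DFunLike.congr_fun (hu.main n h hn.2) v
      rw [RCLike.ofReal_zero, zero_mul]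
      exact h2

theorem conv_sub {𝕜 H : Type*} [RCLike 𝕜] [NormedAddCommGroup H] [InnerProductSpace 𝕜 H]
    (a : ℕ → ℝ) (x y : ℕ → H) (n : ℕ) :
    conv 𝕜 a (fun m => x m - y m) n = conv 𝕜 a x n - conv 𝕜 a y n := by
  simp [conv, smul_sub]

theorem theorem4p3 (k : ℕ) (hk : k = 3 ∨ k = 4 ∨ k = 5 ∨ k = 6) :
    ∃ C : ℝ, 0 < C ∧
      ∀ (𝕜 H : Type*) [RCLike 𝕜] [NormedAddCommGroup H] [InnerProductSpace 𝕜 H] [CompleteSpace H]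
        (A : H →ₗ.[𝕜] H) (hA : BDFSubdiffusion.IsPosDefSelfAdjoint A)
        (ν : MeasureTheory.Measure (Set.Icc (0 : ℝ) 1)) [MeasureTheory.IsFiniteMeasure ν]
        (σ T : ℝ) (_ : 0 ≤ σ) (_ : 0 < T) (N : ℕ) (_ : 0 < N) (τ : ℝ) (_ : τ = T / N)
        (u u' ε : ℕ → BDFSubdiffusion.V hA)
        (_ : BDFSubdiffusion.IsCorrectedBDFSolution hA ν k σ τ N u)
        (_ : BDFSubdiffusion.IsCorrectedBDFSolution hA ν k σ τ N u')
        (_ : ∀ n, n ≤ N → ε n = u' n - u n),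
        τ * ∑ n ∈ Finset.Icc 1 N, BDFSubdiffusion.normV hA (ε n) ^ 2
            ≤ C * (τ * ∑ _n ∈ Finset.Icc 1 N, BDFSubdiffusion.normV hA (ε 0) ^ 2) ∧
          τ * ∑ n ∈ Finset.Icc 1 N, BDFSubdiffusion.normV hA (ε n)
            ≤ C * T * BDFSubdiffusion.normV hA (ε 0) := by
  let M : ℝ := ∑ i ∈ bdfMultiplier.support, |bdfMultiplier.coeff i|
  let K : ℝ := ∑ i ∈ Finset.range k, |BDFSubdiffusion.corrCoeff k i|
  have hK : 0 ≤ K := Finset.sum_nonneg fun _ _ => abs_nonneg _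
  let C : ℝ := 2 * ((K + 1) * M / (1 / 50)) ^ 2 + 2
  have hC : 1 ≤ C := by
    have := sq_nonneg ((K + 1) * M / (1 / 50))
    simp only [C]
    linarith
  refine ⟨C, by linarith, ?_⟩
  intro 𝕜 H _ _ _ _ A hA ν _ σ T hσ hT N hN τ hτT u u' ε hu hu' hε
  have hN' : (0 : ℝ) < N := Nat.cast_pos.2 hN
  have hτ : 0 < τ := hτT ▸ div_pos hT hN'
  let q : ℝ := Real.exp (-σ * τ)
  have hq0 : 0 ≤ q := Real.exp_nonneg _
  have hq1 : q ≤ 1 := exp_neg_mul_le_one hσ hτ.le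
  let B : BDFSubdiffusion.V hA →ₗ[𝕜] H := (BDFSubdiffusion.sqrtOp hA).toFun
  have hB (v) : BDFSubdiffusion.sqrtOp hA v = B v := rfl
  let w : ℕ → ℝ := fun m => Real.exp (-σ * m * τ)
  have hw (m) : |w m| ≤ 1 := by
    rw [abs_of_pos (Real.exp_pos _)]
    refine Real.exp_le_one_iff.2 ?_
    have := mul_nonneg (mul_nonneg hσ (Nat.cast_nonneg (α := ℝ) m)) hτ.le
    linarith
  let d : ℕ → BDFSubdiffusion.V hA := fun n => u' n - u n
  let ψ : ℕ → BDFSubdiffusion.V hA := fun n => d n - (w n : 𝕜) • d 0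
  let P : ℕ → H := BDFSubdiffusion.discreteP 𝕜 ν k σ τ (fun m => (ψ m : H))
  have hψ0 : ψ 0 = 0 := by simp [ψ, w]
  have hBψ (n) : B (d n) = B (ψ n) + (w n : 𝕜) • B (d 0) := by simp [ψ]
  have hPsub (n) : P n = BDFSubdiffusion.discreteP 𝕜 ν k σ τ
        (fun m => (u' m : H) - (Real.exp (-σ * m * τ) : 𝕜) • (u' 0 : H)) n
      - BDFSubdiffusion.discreteP 𝕜 ν k σ τ
        (fun m => (u m : H) - (Real.exp (-σ * m * τ) : 𝕜) • (u 0 : H)) n := by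
    simp only [P, discreteP_eq_conv hk ν hσ hτ]
    rw [← conv_sub]
    congr 1
    funext m
    simp only [ψ, d, w, Submodule.coe_sub, Submodule.coe_smul, smul_sub]
    abel
  have key : ∑ n ∈ Finset.Icc 1 N, ‖B (ψ n)‖ ^ 2
      ≤ ((K + 1) * M / (1 / 50)) ^ 2 * (N * ‖B (d 0)‖ ^ 2) := by
    refine sum_sq_norm_le_of_multiplier (P := P) B hψ0 (by norm_num) N
      (sum_re_inner_discreteP_nonneg hk ν hσ hτ _ _)
      (le_sum_re_inner_conv_bdfMultiplier hq0 hq1 _ _)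
      (sum_abs_coeff_comp_le _ hq0 hq1 _) (by linarith) fun n hn => ?_
    obtain ⟨s, hs, h⟩ := exists_scheme_eq hA ν k hσ hτ.le N n hn
    refine ⟨s - w n, (abs_sub s (w n)).trans (add_le_add hs (hw n)), fun v => ?_⟩
    have h1 := h u hu v
    have h2 := h u' hu' v
    rw [hB, hB, hB] at h1 h2
    rw [hPsub, inner_sub_right]
    simp only [ψ, d, map_sub, map_smul, inner_sub_right, inner_smul_right]
    linear_combination h2 - h1
  have hnorm (n) (hn : n ≤ N) : BDFSubdiffusion.normV hA (ε n) = ‖B (d n)‖ := by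
    rw [hε n hn]
    rfl
  have hcard : ∑ _n ∈ Finset.Icc 1 N, BDFSubdiffusion.normV hA (ε 0) ^ 2
      = N * ‖B (d 0)‖ ^ 2 := by
    rw [Finset.sum_const, Nat.card_Icc, Nat.add_sub_cancel, nsmul_eq_mul, hnorm 0 hN.le]
  have hS : ∑ n ∈ Finset.Icc 1 N, BDFSubdiffusion.normV hA (ε n) ^ 2
      ≤ C * (N * ‖B (d 0)‖ ^ 2) := by
    have h1 (n) (hn : n ∈ Finset.Icc 1 N) : BDFSubdiffusion.normV hA (ε n) ^ 2
        ≤ 2 * ‖B (ψ n)‖ ^ 2 + 2 * ‖B (d 0)‖ ^ 2 := by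
      have h2 : ‖B (d n)‖ ≤ ‖B (ψ n)‖ + ‖B (d 0)‖ := by
        rw [hBψ]
        refine (norm_add_le _ _).trans (add_le_add_right ?_ _)
        rw [norm_smul, RCLike.norm_ofReal]
        exact mul_le_of_le_one_left (norm_nonneg _) (hw n)
      rw [hnorm n (Finset.mem_Icc.1 hn).2]
      have h3 := pow_le_pow_left₀ (norm_nonneg _) h2 2
      nlinarith [sq_nonneg (‖B (ψ n)‖ - ‖B (d 0)‖)]
    refine (Finset.sum_le_sum h1).trans ?_
    rw [Finset.sum_add_distrib, ← Finset.mul_sum, Finset.sum_const, Nat.card_Icc,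
      Nat.add_sub_cancel, nsmul_eq_mul]
    simp only [C]
    linarith
  constructor
  · rw [hcard]
    have := mul_le_mul_of_nonneg_left hS hτ.le
    linarith
  · have hcs := sq_sum_le_card_mul_sum_sq (s := Finset.Icc 1 N)
      (f := fun n => BDFSubdiffusion.normV hA (ε n))
    rw [Nat.card_Icc, Nat.add_sub_cancel] at hcs
    have hsq : (∑ n ∈ Finset.Icc 1 N, BDFSubdiffusion.normV hA (ε n)) ^ 2
        ≤ (C * (N * ‖B (d 0)‖)) ^ 2 := by
      have h1 := hcs.trans (mul_le_mul_of_nonneg_left hS hN'.le)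
      have h2 : C * (N * ‖B (d 0)‖) ^ 2 ≤ C * (C * (N * ‖B (d 0)‖) ^ 2) :=
        le_mul_of_one_le_left (by positivity) hC
      linarith
    have h3 := abs_le_of_sq_le_sq' hsq (by positivity) |>.2
    rw [hnorm 0 hN.le]
    have h4 := mul_le_mul_of_nonneg_left h3 hτ.le
    have h5 : τ * N = T := by rw [hτT]; field_simp
    calc _ ≤ _ := h4
      _ = C * (τ * N) * ‖B (d 0)‖ := by ring
      _ = _ := by rw [h5]
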